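/- Let $m\ge 1$, let $X_1,X_2,\dots$ be i.i.d. real random variables with distribution $F$, and let $h:\mathbb R^m\to\mathbb R$ be Borel measurable and symmetric in its arguments, with $$\mathbb E|h(X_1,\dots,X_m)|^{5/3}<\infty .$$ Put $\theta=\mathbb E\,h(X_1,\dots,X_m)$ and $\tilde h_1(x)=\mathbb E\big(h(X_1,\dots,X_m)-\theta\mid X_1=x\big)$. For $n>m$ let $$U_n=\binom nm^{-1}\sum_{1\le j_1<\dots<j_m\le n}h(X_{j_1},\dots,X_{j_m}),\qquad U^i_{n-1}=\binom{n-1}m^{-1}\sum_{\substack{1\le j_1<\dots<j_m\le n\\ j_1,\dots,j_m\ne i}}h(X_{j_1},\dots,X_{j_m})\quad(1\le i\le n).$$ Assume that $\tilde h_1(X_1)$ is in the domain of attraction of the normal law, i.e. there are constants $A_n\in\mathbb R$ and $B_n>0$ such that $\big(\sum_{i=1}^n\tilde h_1(X_i)-A_n\big)/B_n\to N(0,1)$ in distribution as $n\to\infty$. Let $\ell(n)>0$ be any sequence for which $B_n=n^{1/2}\ell(n)$ is such a choice of norming constants (for some $A_n$). Then, as $n\to\infty$, $$\frac{n-1}{m^2\,\ell^2(n)}\sum_{i=1}^n\big(U^i_{n-1}-U_n\big)^2\longrightarrow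 1\quad\text{in probability.}$$ If moreover $\mathbb E\,h^2(X_1,\dots,X_m)<\infty$, then $\mathbb E\,\tilde h_1^2(X_1)>0$, one may take $A_n=0$ and the constant $\ell(n)=\big(\mathbb E\,\tilde h_1^2(X_1)\big)^{1/2}$, and $$\frac{n-1}{m^2}\sum_{i=1}^n\big(U^i_{n-1}-U_n\big)^2\longrightarrow \mathbb E\,\tilde h_1^2(X_1)\quad\text{in probability.}$$ -/

import Mathlib

open MeasureTheory ProbabilityTheory Filter
open scoped Topology

namespace JackknifeU

noncomputable section

/-- The parameter `θ = ∫_{ℝᵐ} h(x₁, …, xₘ) dF(x₁) ⋯ dF(xₘ)`. -/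
def theta {m : ℕ} (F : Measure ℝ) (h : (Fin m → ℝ) → ℝ) : ℝ :=
  ∫ y, h y ∂(Measure.pi fun _ : Fin m => F)

/-- The first projection `h̃₁(x) = E (h(X₁, …, Xₘ) - θ | X₁ = x)` of the kernel, for independent
`X₁, …, Xₘ` with distribution `F`, that is, `E h(x, X₂, …, Xₘ) - θ`. The integral runs over all
`m` coordinates, the first of which is overwritten by `x`. That this is a version of the
conditional expectation is shown in `hTilde_ae_eq_condExp`. -/
def hTilde {m : ℕ} [NeZero m] (F : Measure ℝ) (h : (Fin m → ℝ) → ℝ) (x : ℝ) : ℝ :=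
  (∫ y, h (Function.update y 0 x) ∂(Measure.pi fun _ : Fin m => F)) - theta F h

/-- The `U`-statistic with kernel `h` based on the observations `x j`, `j ∈ S`: the average of
`h (x j₁, …, x jₘ)` over all `j₁ < ⋯ < jₘ` in `S`. -/
def uStat {m : ℕ} (h : (Fin m → ℝ) → ℝ) (S : Finset ℕ) (x : ℕ → ℝ) : ℝ :=
  ((S.card.choose m : ℕ) : ℝ)⁻¹ *
    ∑ j ∈ (Fintype.piFinset fun _ : Fin m => S) with StrictMono j, h (fun k => x (j k))

/-- `Uₙ`, based on the first `n` observations (which are indexed by `0, …, n - 1`). -/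
def uStatN {m : ℕ} (h : (Fin m → ℝ) → ℝ) (n : ℕ) (x : ℕ → ℝ) : ℝ :=
  uStat h (Finset.range n) x

/-- The jackknifed version `Uⁱₙ₋₁` of `Uₙ`: the observation `x i` is left out. -/
def uStatJack {m : ℕ} (h : (Fin m → ℝ) → ℝ) (n i : ℕ) (x : ℕ → ℝ) : ℝ :=
  uStat h ((Finset.range n).erase i) x

/-- `(n - 1) ∑ᵢ (Uⁱₙ₋₁ - Uₙ)²`. -/
def jackVar {m : ℕ} (h : (Fin m → ℝ) → ℝ) (n : ℕ) (x : ℕ → ℝ) : ℝ :=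
  ((n : ℝ) - 1) * ∑ i ∈ Finset.range n, (uStatJack h n i x - uStatN h n x) ^ 2

/-- `A n` and `B n > 0` are centering and norming constants of a central limit theorem for the
partial sums of `Y`: `(Y₁ + ⋯ + Yₙ - A n) / B n` converges in distribution to `N(0, 1)`. -/
def IsNormalNorming {Ω : Type*} [MeasurableSpace Ω] (P : Measure Ω) [IsProbabilityMeasure P]
    (Y : ℕ → Ω → ℝ) (A B : ℕ → ℝ) : Prop :=
  (∀ n, 1 ≤ n → 0 < B n) ∧
    TendstoInDistribution (fun (n : ℕ) ω => (∑ i ∈ Finset.range n, Y i ω - A n) / B n) atTop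
      (id : ℝ → ℝ) (fun _ => P) (gaussianReal 0 1)

/-- The (i.i.d.) sequence `Y` is in the domain of attraction of the normal law. -/
def InDAN {Ω : Type*} [MeasurableSpace Ω] (P : Measure Ω) [IsProbabilityMeasure P]
    (Y : ℕ → Ω → ℝ) : Prop :=
  ∃ A B : ℕ → ℝ, IsNormalNorming P Y A B

/-- If `Y` is in the domain of attraction of the normal law, then there is an `ℓ` such that
`√n ℓ(n)` are norming constants. -/
theorem InDAN.exists_scale {Ω : Type*} [MeasurableSpace Ω] {P : Measure Ω}
    [IsProbabilityMeasure P] {Y : ℕ → Ω → ℝ} (h : InDAN P Y) :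
    ∃ A ℓ : ℕ → ℝ, IsNormalNorming P Y A (fun n => Real.sqrt n * ℓ n) := by
  obtain ⟨A, B, hB, hc⟩ := h
  have key : ∀ n : ℕ, 1 ≤ n → Real.sqrt n * (B n / Real.sqrt n) = B n := fun n hn => by
    have h0 : (0 : ℝ) < n := by exact_mod_cast hn
    have h1 := Real.sqrt_pos.2 h0
    field_simp
  refine ⟨A, fun n => B n / Real.sqrt n, fun n hn => ?_, ?_, by fun_prop, ?_⟩
  · simp only [key n hn]
    exact hB n hn
  · intro n
    rcases Nat.eq_zero_or_pos n with rfl | hn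
    · simp
    · simp only [key n hn]
      exact hc.forall_aemeasurable n
  · refine hc.tendsto.congr' ?_
    filter_upwards [eventually_ge_atTop 1] with n hn
    simp only [key n hn]
    rfl

/-- Overwriting the first coordinate of a sample by an independent observation does not change
the law of the sample. -/
theorem measurePreserving_update {m : ℕ} [NeZero m] (F : Measure ℝ) [IsProbabilityMeasure F] :
    MeasurePreserving (fun p : ℝ × (Fin m → ℝ) => Function.update p.2 0 p.1)
      (F.prod (Measure.pi fun _ : Fin m => F)) (Measure.pi fun _ : Fin m => F) := by
  have hmeas : Measurable (fun p : ℝ × (Fin m → ℝ) => Function.update p.2 0 p.1) := by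
    refine measurable_pi_lambda _ fun j => ?_
    by_cases hj : j = 0
    · subst hj; simpa using measurable_fst
    · simpa [Function.update_of_ne hj, Function.comp_def] using
        (measurable_pi_apply j).comp (measurable_snd (α := ℝ) (β := Fin m → ℝ))
  refine ⟨hmeas, (Measure.pi_eq fun s hs => ?_).symm⟩
  rw [Measure.map_apply hmeas (MeasurableSet.univ_pi hs)]
  have hpre : (fun p : ℝ × (Fin m → ℝ) => Function.update p.2 0 p.1) ⁻¹' (Set.univ.pi s)
      = s 0 ×ˢ (Set.univ.pi (Function.update s 0 Set.univ)) := by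
    ext p
    simp only [Set.mem_preimage, Set.mem_pi, Set.mem_univ, true_implies, Set.mem_prod]
    constructor
    · intro hp
      refine ⟨by simpa using hp 0, fun j => ?_⟩
      by_cases hj : j = 0
      · subst hj; simp
      · simpa [Function.update_of_ne hj] using hp j
    · rintro ⟨h0, hp⟩ j
      by_cases hj : j = 0
      · subst hj; simpa using h0
      · simpa [Function.update_of_ne hj] using hp j
  rw [hpre, Measure.prod_prod, Measure.pi_pi, ← Finset.mul_prod_erase _ _ (Finset.mem_univ 0),
    ← Finset.mul_prod_erase (Finset.univ) (fun i => F (s i)) (Finset.mem_univ 0)]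
  simp only [Function.update_self, measure_univ, one_mul]
  congr 1
  refine Finset.prod_congr rfl fun j hj => ?_
  rw [Function.update_of_ne (Finset.ne_of_mem_erase hj)]

/-- `h̃₁(X₁)` is a version of `E (h(X₁, …, Xₘ) - θ | X₁)`. -/
theorem hTilde_ae_eq_condExp {Ω : Type*} [MeasurableSpace Ω] (P : Measure Ω)
    [IsProbabilityMeasure P] (F : Measure ℝ) [IsProbabilityMeasure F] (X : ℕ → Ω → ℝ)
    (hX : ∀ i, Measurable (X i)) (hindep : iIndepFun X P) (hlaw : ∀ i, P.map (X i) = F)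
    {m : ℕ} [NeZero m] (h : (Fin m → ℝ) → ℝ) (hmeas : Measurable h)
    (hint : Integrable (fun ω => h (fun k => X k ω)) P) :
    (fun ω => hTilde F h (X 0 ω)) =ᵐ[P]
      P[fun ω => h (fun k => X k ω) - theta F h | MeasurableSpace.comap (X 0) inferInstance] := by
  have hle : MeasurableSpace.comap (X 0) inferInstance ≤ (inferInstance : MeasurableSpace Ω) :=
    (hX 0).comap_le
  have hXm : Measurable (fun ω (k : Fin m) => X k ω) := measurable_pi_lambda _ fun k => hX k
  have hind : iIndepFun (fun (k : Fin m) => X k) P :=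
    hindep.precomp (g := fun k : Fin m => (k : ℕ)) Fin.val_injective
  have hpi : P.map (fun ω (k : Fin m) => X k ω) = Measure.pi fun _ : Fin m => F := by
    rw [(iIndepFun_iff_map_fun_eq_pi_map (f := fun k : Fin m => X k)
      (fun k => (hX k).aemeasurable)).1 hind]
    simp [hlaw]
  have hintpi : Integrable h (Measure.pi fun _ : Fin m => F) := by
    rw [← hpi]
    exact (integrable_map_measure hmeas.aestronglyMeasurable hXm.aemeasurable).2 hint
  have hT := measurePreserving_update (m := m) F
  have hprod : Integrable (fun p : ℝ × (Fin m → ℝ) => h (Function.update p.2 0 p.1))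
      (F.prod (Measure.pi fun _ : Fin m => F)) := hT.integrable_comp_of_integrable hintpi
  have hI : Integrable (fun x => hTilde F h x) F :=
    hprod.integral_prod_left.sub (integrable_const _)
  have hsm : StronglyMeasurable (fun x => hTilde F h x) := by
    have : Measurable (fun p : ℝ × (Fin m → ℝ) => h (Function.update p.2 0 p.1)) :=
      hmeas.comp hT.measurable
    exact (this.stronglyMeasurable.integral_prod_right).sub stronglyMeasurable_const
  refine ae_eq_condExp_of_forall_setIntegral_eq hle (hint.sub (integrable_const _)) ?_ ?_ ?_
  · intro s _ _
    refine Integrable.integrableOn ?_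
    have hI' : Integrable (fun x => hTilde F h x) (P.map (X 0)) := (hlaw 0).symm ▸ hI
    exact (integrable_map_measure hI'.aestronglyMeasurable (hX 0).aemeasurable).1 hI'
  · rintro s ⟨B, hB, rfl⟩ -
    have hc : StronglyMeasurable (fun y : Fin m → ℝ => h y - theta F h) :=
      (hmeas.sub measurable_const).stronglyMeasurable
    have hB0 : MeasurableSet ((fun y : Fin m → ℝ => y 0) ⁻¹' B) := measurable_pi_apply 0 hB
    have e1 : ∫ ω in X 0 ⁻¹' B, hTilde F h (X 0 ω) ∂P = ∫ x in B, hTilde F h x ∂F := by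
      rw [← setIntegral_map hB hsm.aestronglyMeasurable (hX 0).aemeasurable, hlaw 0]
    have e2 : ∫ ω in X 0 ⁻¹' B, (h (fun k => X k ω) - theta F h) ∂P
        = ∫ y in (fun y : Fin m → ℝ => y 0) ⁻¹' B, (h y - theta F h)
            ∂(Measure.pi fun _ : Fin m => F) := by
      rw [← hpi, setIntegral_map hB0 hc.aestronglyMeasurable hXm.aemeasurable]
      rfl
    have e3 : ∫ y in (fun y : Fin m → ℝ => y 0) ⁻¹' B, (h y - theta F h)
            ∂(Measure.pi fun _ : Fin m => F)
        = ∫ p in B ×ˢ Set.univ, (h (Function.update p.2 0 p.1) - theta F h)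
            ∂(F.prod (Measure.pi fun _ : Fin m => F)) := by
      conv_lhs => rw [← hT.map_eq]
      rw [setIntegral_map hB0 hc.aestronglyMeasurable hT.measurable.aemeasurable]
      congr 2
      ext p
      simp
    have hps : Integrable (fun p : ℝ × (Fin m → ℝ) => h (Function.update p.2 0 p.1) - theta F h)
        (F.prod (Measure.pi fun _ : Fin m => F)) := hprod.sub (integrable_const _)
    rw [e1, e2, e3, setIntegral_prod _ hps.integrableOn]
    simp only [Measure.restrict_univ]
    have hae : ∀ᵐ x ∂F, Integrable (fun y => h (Function.update y 0 x))
        (Measure.pi fun _ : Fin m => F) := hprod.prod_right_ae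
    refine integral_congr_ae ?_
    filter_upwards [ae_restrict_of_ae hae] with x hx
    rw [integral_sub hx (integrable_const _)]
    simp [hTilde]
  · exact (hsm.comp_measurable (comap_measurable (X 0))).aestronglyMeasurable

end

end JackknifeU

namespace JackknifeU

/-! Let Vᵢ (`throughAvg`) be the average of h over the increasing tuples below n that contain i. A
proportion m/n of all tuples contains i, so Uⁱₙ₋₁ - Uₙ = m/(n-m) · (Uₙ - Vᵢ)
(`uStatJack_sub_uStatN`), and Uₙ is the mean of the Vᵢ: the jackknife sum is a multiple of their
empirical variance. Split Vᵢ - θ = Yᵢ + Rᵢ with Yᵢ = h̃₁(Xᵢ). It suffices that ∑ Yᵢ² / (n ℓ²) → 1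
and n⁻¹ ∑ Rᵢ² → 0 in probability. Since ℓ² is eventually bounded below, Cauchy-Schwarz disposes of
the cross term and the law of large numbers of the centering term (`tendstoInMeasure_jackVar_div`).

The first limit is Raikov's theorem (`tendstoInMeasure_sum_sq_div_sq_norming`), proved with
characteristic functions. The modulus |φ(t/Bₙ)|ⁿ → exp(-t²/2) does not see the centering Aₙ. As Y
has mean zero and a 5/3 moment, Im φ is of smaller order, and n (1 - Re φ(t/Bₙ)) → t²/2 with a
quadratic bound in t. Averaging over a Gaussian t turns cosines into exp(-l Y²/Bₙ²), so the Laplace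
transform of ∑ Yᵢ²/Bₙ² tends to exp(-l), that of the constant 1.

The second limit (`tendstoInMeasure_sum_throughAvg_sub_proj_sq`) truncates h at level n. For the
bounded part, the terms of Vᵢ are centred given Xᵢ and uncorrelated unless they share an index
besides i, which happens for a proportion O(1/n) of the pairs; this gives E Rᵢ² = O(n⁻¹ n^(1/3)).
For the tail an L¹ bound of order n^(-2/3) is enough.

If h is square integrable, the classical central limit theorem makes √n (E h̃₁²)^(1/2) a norming
sequence, to which the general result applies; E h̃₁² = 0 is impossible because the degenerate law
at 0 has no normal norming. -/

/-- `1 - Re φ(s)` for the characteristic function `φ` of `μ`. -/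
noncomputable def cosDefect (μ : Measure ℝ) (s : ℝ) : ℝ := ∫ y, (1 - Real.cos (s * y)) ∂μ

/-! ### The real and imaginary parts of a characteristic function near the origin. -/

section CosDefect

lemma cosDefect_nonneg (μ : Measure ℝ) (s : ℝ) : 0 ≤ cosDefect μ s :=
  integral_nonneg fun y => by simpa using Real.cos_le_one (s * y)

variable (μ : Measure ℝ) [IsProbabilityMeasure μ]

lemma integrable_one_sub_cos (s : ℝ) : Integrable (fun y => 1 - Real.cos (s * y)) μ := by
  refine Integrable.of_bound (C := 2) (by fun_prop) (ae_of_all _ fun y => ?_)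
  rw [Real.norm_eq_abs, abs_le]
  constructor <;> linarith [Real.cos_le_one (s * y), Real.neg_one_le_cos (s * y)]

lemma integrable_sin_mul (s : ℝ) : Integrable (fun y => Real.sin (s * y)) μ :=
  Integrable.of_bound (C := 1) (by fun_prop) (ae_of_all _ fun y => Real.abs_sin_le_one _)

/-- Pointwise, 1 - cos 2x = 2 (1 - cos x)(1 + cos x) ≤ 4 (1 - cos x). Iterated, this extends a bound
near the origin to a quadratic bound on the whole line. -/
lemma cosDefect_two_mul_le (s : ℝ) : cosDefect μ (2 * s) ≤ 4 * cosDefect μ s := by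
  unfold cosDefect
  rw [← integral_const_mul]
  refine integral_mono (integrable_one_sub_cos μ _) ((integrable_one_sub_cos μ s).const_mul 4)
    fun y => ?_
  have : Real.cos (2 * s * y) = 2 * Real.cos (s * y) ^ 2 - 1 := by
    rw [mul_assoc, Real.cos_two_mul]
  simp only [this]
  nlinarith [sq_nonneg (1 - Real.cos (s * y))]

lemma cosDefect_two_pow_mul_le (k : ℕ) (s : ℝ) :
    cosDefect μ (2 ^ k * s) ≤ 4 ^ k * cosDefect μ s := by
  induction k with
  | zero => simp
  | succ k ih =>
    have := cosDefect_two_mul_le μ (2 ^ k * s)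
    rw [pow_succ', pow_succ', mul_assoc]
    linarith

lemma norm_charFun_sq (s : ℝ) :
    ‖charFun μ s‖ ^ 2 = (1 - cosDefect μ s) ^ 2 + (∫ y, Real.sin (s * y) ∂μ) ^ 2 := by
  have hint : Integrable (fun y : ℝ => Complex.exp (s * y * Complex.I)) μ := by
    refine Integrable.of_bound (C := 1) (by fun_prop) (ae_of_all _ fun y => ?_)
    rw [← Complex.ofReal_mul, Complex.norm_exp_ofReal_mul_I]
  have hre : (charFun μ s).re = 1 - cosDefect μ s := by
    rw [charFun_apply_real, ← RCLike.re_eq_complex_re, ← integral_re hint, cosDefect,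
      integral_sub (integrable_const _)]
    · simp only [integral_const, probReal_univ, smul_eq_mul, mul_one, sub_sub_cancel]
      refine integral_congr_ae (ae_of_all _ fun y => ?_)
      simp only [RCLike.re_eq_complex_re]
      rw [← Complex.ofReal_mul, Complex.exp_ofReal_mul_I_re]
    · exact Integrable.of_bound (C := 1) (by fun_prop) (ae_of_all _ fun y => Real.abs_cos_le_one _)
  have him : (charFun μ s).im = ∫ y, Real.sin (s * y) ∂μ := by
    rw [charFun_apply_real, ← RCLike.im_eq_complex_im, ← integral_im hint]
    refine integral_congr_ae (ae_of_all _ fun y => ?_)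
    simp only [RCLike.im_eq_complex_im]
    rw [← Complex.ofReal_mul, Complex.exp_ofReal_mul_I_im]
  rw [← hre, ← him, Complex.sq_norm, Complex.normSq_apply]
  ring

/-- The difference is O(|a|³) for small a and O(|a|) for large a; the exponent 5/3 lies between 1
and 3. -/
lemma abs_sin_sub_self_le (a : ℝ) : |Real.sin a - a| ≤ 2 * |a| ^ (5 / 3 : ℝ) := by
  rcases le_total |a| 1 with ha | ha
  · have h1 := Real.sin_bound ha
    have h0 := abs_nonneg a
    have h3 : |a| ^ 3 ≤ |a| ^ (5 / 3 : ℝ) := by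
      rw [← Real.rpow_natCast]
      exact Real.rpow_le_rpow_of_exponent_ge' h0 ha (by norm_num) (by norm_num)
    have h5 : |a| ^ 5 ≤ |a| ^ 3 := pow_le_pow_of_le_one h0 ha (by norm_num)
    have e : Real.sin a - a = (Real.sin a - (a - a ^ 3 / 6)) + -(a ^ 3 / 6) := by ring
    have h6 : |-(a ^ 3 / 6)| = |a| ^ 3 / 6 := by rw [abs_neg, abs_div, abs_pow]; norm_num
    rw [e]
    refine (abs_add_le _ _).trans ?_
    rw [h6]
    linarith [pow_nonneg h0 3]
  · have h1 : |a| ≤ |a| ^ (5 / 3 : ℝ) := by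
      conv_lhs => rw [← Real.rpow_one |a|]
      exact Real.rpow_le_rpow_of_exponent_le ha (by norm_num)
    calc |Real.sin a - a| ≤ |Real.sin a| + |a| := abs_sub _ _
      _ ≤ 1 + |a| := by gcongr; exact Real.abs_sin_le_one a
      _ ≤ 2 * |a| ^ (5 / 3 : ℝ) := by linarith

/-- With mean zero, sin(sy) may be replaced by sin(sy) - sy, which gives O(|s|^(5/3)). The square is
O(|s|^(10/3)), hence O(|s|³): negligible against s². -/
lemma sq_integral_sin_le (h0 : Integrable (fun y : ℝ => y) μ)
    (h1 : Integrable (fun y : ℝ => |y| ^ (5 / 3 : ℝ)) μ) (hmean : ∫ y, y ∂μ = 0) :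
    ∃ C : ℝ, 0 < C ∧
      ∀ s : ℝ, |s| ≤ 1 → (∫ y, Real.sin (s * y) ∂μ) ^ 2 ≤ C * |s| ^ 3 := by
  set D := 2 * ∫ y, |y| ^ (5 / 3 : ℝ) ∂μ with hD
  have hD0 : 0 ≤ D := mul_nonneg (by norm_num) (integral_nonneg fun y => by positivity)
  -- The summand 1 only makes the constant positive, so that one may later divide by it.
  refine ⟨D ^ 2 + 1, by positivity, fun s hs => ?_⟩
  have e : ∫ y, Real.sin (s * y) ∂μ = ∫ y, (Real.sin (s * y) - s * y) ∂μ := by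
    rw [integral_sub (integrable_sin_mul μ s) (h0.const_mul s), integral_const_mul, hmean]
    simp
  have hb : |∫ y, Real.sin (s * y) ∂μ| ≤ |s| ^ (5 / 3 : ℝ) * D := by
    rw [e, hD]
    calc |∫ y, (Real.sin (s * y) - s * y) ∂μ| ≤ ∫ y, |Real.sin (s * y) - s * y| ∂μ :=
          abs_integral_le_integral_abs
      _ ≤ ∫ y, |s| ^ (5 / 3 : ℝ) * (2 * |y| ^ (5 / 3 : ℝ)) ∂μ := by
          refine integral_mono ((integrable_sin_mul μ s).sub (h0.const_mul s)).abs
            ((h1.const_mul 2).const_mul _) fun y => ?_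
          refine (abs_sin_sub_self_le _).trans_eq ?_
          rw [abs_mul, Real.mul_rpow (abs_nonneg _) (abs_nonneg _)]
          ring
      _ = |s| ^ (5 / 3 : ℝ) * (2 * ∫ y, |y| ^ (5 / 3 : ℝ) ∂μ) := by
          rw [integral_const_mul, integral_const_mul]
  have hs3 : (|s| ^ (5 / 3 : ℝ)) ^ 2 ≤ |s| ^ 3 := by
    rw [← Real.rpow_mul_natCast (abs_nonneg s), ← Real.rpow_natCast |s| 3]
    exact Real.rpow_le_rpow_of_exponent_ge' (abs_nonneg s) hs (by norm_num) (by norm_num)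
  calc (∫ y, Real.sin (s * y) ∂μ) ^ 2 = |∫ y, Real.sin (s * y) ∂μ| ^ 2 := (sq_abs _).symm
    _ ≤ (|s| ^ (5 / 3 : ℝ) * D) ^ 2 := by gcongr
    _ = D ^ 2 * (|s| ^ (5 / 3 : ℝ)) ^ 2 := by ring
    _ ≤ D ^ 2 * |s| ^ 3 := by gcongr
    _ ≤ (D ^ 2 + 1) * |s| ^ 3 := by gcongr; linarith

/-- Some shell (k+1)⁻¹ ≤ |y| ≤ k+1 has positive mass. For |s| ≤ (k+1)⁻¹ the product sy stays in [-1,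
1] there, where 1 - cos x ≥ 2x²/π². -/
lemma exists_mul_sq_le_cosDefect (hμ : ¬ ∀ᵐ y ∂μ, y = 0) :
    ∃ c s₁ : ℝ, 0 < c ∧ 0 < s₁ ∧ ∀ s : ℝ, |s| ≤ s₁ → c * s ^ 2 ≤ cosDefect μ s := by
  let S : ℕ → Set ℝ := fun k => {y | ((k : ℝ) + 1)⁻¹ ≤ |y| ∧ |y| ≤ k + 1}
  have hS : ∀ k, MeasurableSet (S k) := fun k =>
    (measurableSet_le (f := fun _ : ℝ => ((k : ℝ) + 1)⁻¹) (g := fun y : ℝ => |y|)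
      (by fun_prop) (by fun_prop)).inter
      (measurableSet_le (f := fun y : ℝ => |y|) (g := fun _ => (k : ℝ) + 1)
        (by fun_prop) (by fun_prop))
  obtain ⟨k, hk⟩ : ∃ k, μ (S k) ≠ 0 := by
    by_contra! hcon
    apply hμ
    rw [ae_iff]
    refine measure_mono_null ?_ (measure_iUnion_null hcon)
    intro y hy
    have hy' : 0 < |y| := abs_pos.2 hy
    obtain ⟨k, hk⟩ := exists_nat_ge (max |y| |y|⁻¹)
    refine Set.mem_iUnion.2 ⟨k, ?_, ?_⟩
    · rw [inv_le_comm₀ (by positivity) hy']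
      exact (le_max_right _ _).trans (hk.trans (by linarith))
    · exact (le_max_left _ _).trans (hk.trans (by linarith))
  have hk' : 0 < μ.real (S k) := by
    rw [measureReal_def]; exact ENNReal.toReal_pos hk (measure_ne_top _ _)
  have hpi := Real.pi_pos
  refine ⟨2 / Real.pi ^ 2 * ((k : ℝ) + 1)⁻¹ ^ 2 * μ.real (S k), ((k : ℝ) + 1)⁻¹, by positivity,
    by positivity, fun s hs => ?_⟩
  calc 2 / Real.pi ^ 2 * ((k : ℝ) + 1)⁻¹ ^ 2 * μ.real (S k) * s ^ 2
      = ∫ y in S k, 2 / Real.pi ^ 2 * ((k : ℝ) + 1)⁻¹ ^ 2 * s ^ 2 ∂μ := by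
        rw [setIntegral_const, smul_eq_mul]; ring
    _ ≤ ∫ y in S k, (1 - Real.cos (s * y)) ∂μ := by
        refine setIntegral_mono_on (integrable_const _).integrableOn
          (integrable_one_sub_cos μ s).integrableOn (hS k) fun y hy => ?_
        have h1 : |s * y| ≤ 1 := by
          rw [abs_mul]
          calc |s| * |y| ≤ ((k : ℝ) + 1)⁻¹ * (k + 1) :=
                mul_le_mul hs hy.2 (abs_nonneg _) (by positivity)
            _ = 1 := inv_mul_cancel₀ (by positivity)
        have h2 := Real.cos_le_one_sub_mul_cos_sq
          (h1.trans (by linarith [Real.pi_gt_three]))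
        have h3 : ((k : ℝ) + 1)⁻¹ ^ 2 ≤ y ^ 2 := by
          rw [← sq_abs y]; exact pow_le_pow_left₀ (by positivity) hy.1 2
        have h4 : 2 / Real.pi ^ 2 * ((k : ℝ) + 1)⁻¹ ^ 2 * s ^ 2
            ≤ 2 / Real.pi ^ 2 * (s * y) ^ 2 := by
          rw [mul_pow, mul_assoc, mul_comm (s ^ 2)]
          gcongr
        linarith
    _ ≤ cosDefect μ s :=
        setIntegral_le_integral (integrable_one_sub_cos μ s)
          (ae_of_all _ fun y => by simpa using Real.cos_le_one (s * y))

lemma tendsto_cosDefect_zero : Tendsto (cosDefect μ) (𝓝 0) (𝓝 0) := by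
  have : Tendsto (cosDefect μ) (𝓝 0) (𝓝 (∫ y, (1 - Real.cos (0 * y)) ∂μ)) := by
    refine tendsto_integral_filter_of_dominated_convergence (fun _ => 2)
      (Eventually.of_forall fun s => by fun_prop) (Eventually.of_forall fun s =>
        ae_of_all _ fun y => ?_) (integrable_const _) (ae_of_all _ fun y => ?_)
    · rw [Real.norm_eq_abs, abs_le]
      constructor <;> linarith [Real.cos_le_one (s * y), Real.neg_one_le_cos (s * y)]
    · exact (by fun_prop : Continuous fun s : ℝ => 1 - Real.cos (s * y)).tendsto 0
  simpa using this

/-- Near the origin `1 - Re φ` is dominated by `1 - |φ|²` when `μ` is centred and nondegenerate. -/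
lemma exists_cosDefect_le (hμ : ¬ ∀ᵐ y ∂μ, y = 0) (h0 : Integrable (fun y : ℝ => y) μ)
    (h1 : Integrable (fun y : ℝ => |y| ^ (5 / 3 : ℝ)) μ) (hmean : ∫ y, y ∂μ = 0) :
    ∃ c s₁ : ℝ, 0 < c ∧ 0 < s₁ ∧ ∀ s : ℝ, |s| ≤ s₁ →
      c * s ^ 2 ≤ cosDefect μ s ∧ cosDefect μ s ≤ 1 - ‖charFun μ s‖ ^ 2 := by
  obtain ⟨c, s₁, hc, hs₁, H⟩ := exists_mul_sq_le_cosDefect μ hμ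
  obtain ⟨C, hC, HC⟩ := sq_integral_sin_le μ h0 h1 hmean
  obtain ⟨s₂, hs₂, H₂⟩ := Metric.eventually_nhds_iff.1
    ((tendsto_cosDefect_zero μ).eventually (gt_mem_nhds (by norm_num : (0 : ℝ) < 1 / 2)))
  -- With d = `cosDefect μ s` and b the sine integral, 1 - |φ|² = 2d - d² - b². The radius makes d <
  -- 1/2, so d² ≤ d/2, and b² ≤ C|s|³ ≤ c s²/2 ≤ d/2; the last estimate is the origin of c/(2C).
  refine ⟨c, min (min s₁ (s₂ / 2)) (min 1 (c / (2 * C))), hc, by positivity, fun s hs => ?_⟩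
  simp only [le_min_iff] at hs
  obtain ⟨⟨a1, a2⟩, a3, a4⟩ := hs
  have b1 := H s a1
  have b2 : cosDefect μ s < 1 / 2 := H₂ (by rw [Real.dist_eq, sub_zero]; linarith)
  have b3 := HC s a3
  have b4 : C * |s| ^ 3 ≤ c * s ^ 2 / 2 := by
    have : |s| ^ 3 = |s| * s ^ 2 := by rw [pow_succ, sq_abs]; ring
    rw [this]
    have : C * |s| ≤ c / 2 := by
      rw [le_div_iff₀ (by positivity)] at a4; linarith
    nlinarith [sq_nonneg s]
  refine ⟨b1, ?_⟩
  rw [norm_charFun_sq]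
  nlinarith [cosDefect_nonneg μ s]

end CosDefect

/-! ### From powers aⁿ to the size of n (1 - a). -/

lemma nat_mul_one_sub_sq_le_one {a : ℝ} {n : ℕ} (h0 : 0 ≤ a) (h1 : a ≤ 1)
    (h : 7 / 8 ≤ a ^ n) : n * (1 - a ^ 2) ≤ 1 := by
  rcases Nat.eq_zero_or_pos n with rfl | hn
  · simp
  have ha : 0 < a := by
    rcases h0.eq_or_lt with rfl | h'
    · rw [zero_pow hn.ne'] at h; norm_num at h
    · exact h'
  -- n (1 - a) ≤ -n log a ≤ a⁻ⁿ - 1 ≤ 1/7, and 1 - a² ≤ 2 (1 - a).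
  have e1 := Real.one_sub_inv_le_log_of_pos (pow_pos ha n)
  rw [Real.log_pow] at e1
  have e2 := mul_le_mul_of_nonneg_left (Real.log_le_sub_one_of_pos ha) (Nat.cast_nonneg (α := ℝ) n)
  have e3 : (a ^ n)⁻¹ ≤ 8 / 7 := by
    rw [inv_le_comm₀ (pow_pos ha n) (by norm_num)]; norm_num; exact h
  have e4 : (n : ℝ) * (1 - a) ≤ 1 / 7 := by linarith
  have e5 : 0 ≤ (n : ℝ) * (1 - a) := mul_nonneg (Nat.cast_nonneg n) (by linarith)
  nlinarith

/-- From 1 - 1/a ≤ log a ≤ a - 1, the quantity n (1 - a) lies between -a n log a and -n log a; both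
tend to v because a → 1. -/
lemma tendsto_nat_mul_one_sub {a : ℕ → ℝ} {v : ℝ} (h0 : ∀ n, 0 ≤ a n)
    (h : Tendsto (fun n => a n ^ n) atTop (𝓝 (Real.exp (-v)))) :
    Tendsto (fun n : ℕ => n * (1 - a n)) atTop (𝓝 v) := by
  have hlog : Tendsto (fun n : ℕ => (n : ℝ) * Real.log (a n)) atTop (𝓝 (-v)) := by
    have := (Real.continuousAt_log (Real.exp_pos (-v)).ne').tendsto.comp h
    simpa [Function.comp_def, Real.log_pow] using this
  have hpos : ∀ᶠ n in atTop, 0 < a n := by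
    filter_upwards [h.eventually (lt_mem_nhds (Real.exp_pos _)), eventually_ge_atTop 1] with n hn h1
    rcases (h0 n).eq_or_lt with h' | h'
    · rw [← h', zero_pow (by omega)] at hn; exact absurd hn (lt_irrefl _)
    · exact h'
  have ha : Tendsto a atTop (𝓝 1) := by
    have h1 : Tendsto (fun n : ℕ => Real.log (a n)) atTop (𝓝 0) := by
      have := hlog.mul tendsto_inv_atTop_nhds_zero_nat
      rw [mul_zero] at this
      refine this.congr' ?_
      filter_upwards [eventually_ge_atTop 1] with n hn
      have : (n : ℝ) ≠ 0 := by positivity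
      field_simp
    have h2 := (Real.continuous_exp.tendsto 0).comp h1
    rw [Real.exp_zero] at h2
    refine h2.congr' ?_
    filter_upwards [hpos] with n hn
    simp [Real.exp_log hn]
  have hup : Tendsto (fun n : ℕ => -((n : ℝ) * Real.log (a n))) atTop (𝓝 v) := by
    simpa using hlog.neg
  have hlow : Tendsto (fun n : ℕ => a n * -((n : ℝ) * Real.log (a n))) atTop (𝓝 v) := by
    simpa using ha.mul hup
  refine tendsto_of_tendsto_of_tendsto_of_le_of_le' hlow hup ?_ ?_
  · filter_upwards [hpos] with n hn
    have e1 := Real.one_sub_inv_le_log_of_pos hn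
    have e2 : a n * (1 - (a n)⁻¹) ≤ a n * Real.log (a n) := by gcongr
    rw [mul_sub, mul_inv_cancel₀ hn.ne', mul_one] at e2
    nlinarith [Nat.cast_nonneg (α := ℝ) n]
  · filter_upwards [hpos] with n hn
    have e1 := Real.log_le_sub_one_of_pos hn
    nlinarith [Nat.cast_nonneg (α := ℝ) n]

/-! ### Consequences of asymptotic normality for the norming constants and the Laplace transform. -/

section Norming

variable {μ : Measure ℝ} [IsProbabilityMeasure μ] {B : ℕ → ℝ}

/-- For the point mass at 0 the modulus is constantly 1, which differs from the limit exp(-1/2) at t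
= 1. -/
lemma not_ae_eq_zero_of_tendsto_charFun
    (H1 : ∀ t : ℝ, Tendsto (fun n : ℕ => ‖charFun μ (t / B n)‖ ^ n) atTop
      (𝓝 (Real.exp (-(t ^ 2 / 2))))) : ¬ ∀ᵐ y ∂μ, y = 0 := by
  intro h
  have h1 : ∀ t, charFun μ t = 1 := fun t => by
    rw [charFun_apply_real]
    have : ∫ x : ℝ, Complex.exp (t * x * Complex.I) ∂μ = ∫ x : ℝ, 1 ∂μ := by
      refine integral_congr_ae ?_
      filter_upwards [h] with y hy
      simp [hy]
    simpa using this
  have h2 := H1 1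
  simp only [h1, norm_one, one_pow] at h2
  have h3 := tendsto_nhds_unique h2 tendsto_const_nhds
  rw [Real.exp_eq_one_iff] at h3
  norm_num at h3

variable (hB : ∀ n, 1 ≤ n → 0 < B n)
  {δ : ℝ} (hδ : 0 < δ)
  (H2 : ∀ᶠ n in atTop, ∀ t : ℝ, |t| ≤ δ → 7 / 8 ≤ ‖charFun μ (t / B n)‖ ^ n)

include hB hδ H2

/-- If s Bₙ ≤ δ then n c s² ≤ n (1 - |φ(s)|²) ≤ 1. For large n this rules out s = s₁, so s₁ Bₙ > δ
and s = δ/Bₙ is admissible, giving n c δ² ≤ Bₙ². -/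
lemma exists_nat_le_sq_norming {c s₁ : ℝ} (hc : 0 < c) (hs₁ : 0 < s₁)
    (hs : ∀ s : ℝ, |s| ≤ s₁ →
      c * s ^ 2 ≤ cosDefect μ s ∧ cosDefect μ s ≤ 1 - ‖charFun μ s‖ ^ 2) :
    ∃ c' : ℝ, 0 < c' ∧ ∀ᶠ n : ℕ in atTop, c' * n ≤ B n ^ 2 := by
  refine ⟨c * δ ^ 2, by positivity, ?_⟩
  have hN : ∀ᶠ n : ℕ in atTop, 1 / (c * s₁ ^ 2) < n :=
    tendsto_natCast_atTop_atTop.eventually_gt_atTop _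
  filter_upwards [H2, hN, eventually_ge_atTop 1] with n h2 hn h1
  have hBn := hB n h1
  have key : ∀ s : ℝ, 0 ≤ s → s ≤ s₁ → s * B n ≤ δ → n * (c * s ^ 2) ≤ 1 := by
    intro s h0 hs1 hsB
    have e := hs s (by rwa [abs_of_nonneg h0])
    have e2 := h2 (s * B n) (by rwa [abs_of_nonneg (by positivity)])
    rw [mul_div_cancel_right₀ _ hBn.ne'] at e2
    refine le_trans ?_ (nat_mul_one_sub_sq_le_one (norm_nonneg _) (norm_charFun_le_one _) e2)
    gcongr
    exact e.1.trans e.2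
  by_cases hcase : s₁ * B n ≤ δ
  · exfalso
    have := key s₁ hs₁.le le_rfl hcase
    rw [div_lt_iff₀ (by positivity)] at hn
    linarith
  · push Not at hcase
    have := key (δ / B n) (by positivity) (by rw [div_le_iff₀ hBn]; exact hcase.le)
      (by rw [div_mul_cancel₀ _ hBn.ne'])
    rw [div_pow, ← mul_div_assoc, ← mul_div_assoc, div_le_one (by positivity)] at this
    linarith

lemma eventually_nat_mul_cosDefect_le_one {c s₁ : ℝ} (hc : 0 < c) (hs₁ : 0 < s₁)
    (hs : ∀ s : ℝ, |s| ≤ s₁ →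
      c * s ^ 2 ≤ cosDefect μ s ∧ cosDefect μ s ≤ 1 - ‖charFun μ s‖ ^ 2) :
    ∀ᶠ n : ℕ in atTop, ∀ t : ℝ, |t| ≤ δ → n * cosDefect μ (t / B n) ≤ 1 := by
  obtain ⟨c', hc', hB'⟩ := exists_nat_le_sq_norming hB hδ H2 hc hs₁ hs
  have hN : ∀ᶠ n : ℕ in atTop, δ ^ 2 / (c' * s₁ ^ 2) < n :=
    tendsto_natCast_atTop_atTop.eventually_gt_atTop _
  filter_upwards [H2, hB', hN, eventually_ge_atTop 1] with n h2 hb hn h1 t ht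
  have hBn := hB n h1
  have e : |t / B n| ≤ s₁ := by
    rw [abs_div, abs_of_pos hBn, div_le_iff₀ hBn]
    rw [div_lt_iff₀ (by positivity)] at hn
    refine ht.trans (abs_le_of_sq_le_sq' ?_ (by positivity)).2
    rw [mul_pow]
    nlinarith [sq_nonneg s₁]
  refine le_trans ?_
    (nat_mul_one_sub_sq_le_one (norm_nonneg _) (norm_charFun_le_one _) (h2 t ht))
  gcongr
  exact (hs _ e).2

/-- This is the dominating function for the Gaussian average: convergence for each t does not
suffice there. Halving t until it is at most δ costs k + 1 steps with 2ᵏ ≤ |t|/δ, hence a factor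
4^(k+1) ≤ 4t²/δ². -/
lemma eventually_nat_mul_cosDefect_le {c s₁ : ℝ} (hc : 0 < c) (hs₁ : 0 < s₁)
    (hs : ∀ s : ℝ, |s| ≤ s₁ →
      c * s ^ 2 ≤ cosDefect μ s ∧ cosDefect μ s ≤ 1 - ‖charFun μ s‖ ^ 2) :
    ∀ᶠ n : ℕ in atTop, ∀ t : ℝ, n * cosDefect μ (t / B n) ≤ 1 + 4 / δ ^ 2 * t ^ 2 := by
  filter_upwards [eventually_nat_mul_cosDefect_le_one hB hδ H2 hc hs₁ hs] with n hn t
  by_cases ht : |t| ≤ δ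
  · exact (hn t ht).trans (le_add_of_nonneg_right (by positivity))
  · push Not at ht
    obtain ⟨k, hk1, hk2⟩ := exists_nat_pow_near (x := |t| / δ) (y := 2)
      (by rw [le_div_iff₀ hδ]; linarith) (by norm_num)
    have e : t / B n = 2 ^ (k + 1) * (t / 2 ^ (k + 1) / B n) := by field_simp
    have e1 : |t / 2 ^ (k + 1)| ≤ δ := by
      rw [abs_div, abs_of_pos (by positivity : (0 : ℝ) < 2 ^ (k + 1)), div_le_iff₀ (by positivity)]
      rw [div_lt_iff₀ hδ] at hk2
      linarith
    have e2 := hn _ e1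
    have e3 := cosDefect_two_pow_mul_le μ (k + 1) (t / 2 ^ (k + 1) / B n)
    rw [← e] at e3
    have e4 : (4 : ℝ) ^ (k + 1) ≤ 4 / δ ^ 2 * t ^ 2 := by
      have : ((2 : ℝ) ^ k) ^ 2 ≤ (|t| / δ) ^ 2 := by gcongr
      rw [div_pow, sq_abs, ← pow_mul, mul_comm k 2, pow_mul] at this
      norm_num at this
      rw [pow_succ, div_mul_eq_mul_div, mul_div_assoc]
      linarith
    calc (n : ℝ) * cosDefect μ (t / B n)
        ≤ n * (4 ^ (k + 1) * cosDefect μ (t / 2 ^ (k + 1) / B n)) := by gcongr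
      _ = 4 ^ (k + 1) * (n * cosDefect μ (t / 2 ^ (k + 1) / B n)) := by ring
      _ ≤ 4 ^ (k + 1) * 1 := by gcongr
      _ ≤ 1 + 4 / δ ^ 2 * t ^ 2 := by linarith

/-- Write 2 (1 - Re φ) = (1 - |φ|²) + (1 - Re φ)² + (Im φ)² at t/Bₙ and multiply by n. The first
term tends to t². The second is a bounded factor times 1 - Re φ → 0, and the third is at most C t²
(n/Bₙ²) |t/Bₙ| → 0. -/
lemma tendsto_nat_mul_cosDefect {c s₁ : ℝ} (hc : 0 < c) (hs₁ : 0 < s₁)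
    (hs : ∀ s : ℝ, |s| ≤ s₁ →
      c * s ^ 2 ≤ cosDefect μ s ∧ cosDefect μ s ≤ 1 - ‖charFun μ s‖ ^ 2)
    (H1 : ∀ t : ℝ, Tendsto (fun n : ℕ => ‖charFun μ (t / B n)‖ ^ n) atTop
      (𝓝 (Real.exp (-(t ^ 2 / 2)))))
    {C : ℝ} (HC : ∀ s : ℝ, |s| ≤ 1 → (∫ y, Real.sin (s * y) ∂μ) ^ 2 ≤ C * |s| ^ 3) (t : ℝ) :
    Tendsto (fun n : ℕ => n * cosDefect μ (t / B n)) atTop (𝓝 (t ^ 2 / 2)) := by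
  obtain ⟨c', hc', hB'⟩ := exists_nat_le_sq_norming hB hδ H2 hc hs₁ hs
  have hU := eventually_nat_mul_cosDefect_le hB hδ H2 hc hs₁ hs
  have hBtop : Tendsto B atTop atTop := by
    have h1 : Tendsto (fun n : ℕ => Real.sqrt (c' * n)) atTop atTop :=
      Real.tendsto_sqrt_atTop.comp
        ((tendsto_natCast_atTop_atTop (R := ℝ)).const_mul_atTop hc')
    refine tendsto_atTop_mono' _ ?_ h1
    filter_upwards [hB', eventually_ge_atTop 1] with n hn h1
    exact Real.sqrt_le_iff.2 ⟨(hB n h1).le, hn⟩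
  have hsmall : Tendsto (fun n => t / B n) atTop (𝓝 0) := hBtop.const_div_atTop t
  have hnorm : Tendsto (fun n : ℕ => n * (1 - ‖charFun μ (t / B n)‖ ^ 2)) atTop (𝓝 (t ^ 2)) := by
    refine tendsto_nat_mul_one_sub (fun n => by positivity) ?_
    have := (H1 t).pow 2
    rw [← Real.exp_nat_mul] at this
    convert this using 2
    · ring
    · congr 1; push_cast; ring
  have hr2 : Tendsto (fun n : ℕ => n * cosDefect μ (t / B n) ^ 2) atTop (𝓝 0) := by
    have h1 : Tendsto (fun n : ℕ => (1 + 4 / δ ^ 2 * t ^ 2) * cosDefect μ (t / B n)) atTop (𝓝 0) := by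
      simpa using ((tendsto_cosDefect_zero μ).comp hsmall).const_mul (1 + 4 / δ ^ 2 * t ^ 2)
    refine squeeze_zero' (Eventually.of_forall fun n => by positivity) ?_ h1
    filter_upwards [hU] with n hn
    have := mul_le_mul_of_nonneg_right (hn t) (cosDefect_nonneg μ (t / B n))
    linarith
  have him : Tendsto (fun n : ℕ => n * (∫ y, Real.sin (t / B n * y) ∂μ) ^ 2) atTop (𝓝 0) := by
    have hC0 : 0 ≤ C := by
      have := (sq_nonneg _).trans (HC 1 (by simp)); simpa using this
    have h1 : Tendsto (fun n : ℕ => C * t ^ 2 / c' * |t / B n|) atTop (𝓝 0) := by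
      simpa using hsmall.abs.const_mul (C * t ^ 2 / c')
    refine squeeze_zero' (Eventually.of_forall fun n => by positivity) ?_ h1
    have hs1 : ∀ᶠ n in atTop, |t / B n| < 1 := by
      have := hsmall.abs
      rw [abs_zero] at this
      exact this.eventually (gt_mem_nhds one_pos)
    filter_upwards [hB', hs1, eventually_ge_atTop 1] with n hb h1 hn
    have hBn := hB n hn
    have e1 := HC _ h1.le
    have e2 : |t / B n| ^ 3 = t ^ 2 / B n ^ 2 * |t / B n| := by
      rw [pow_succ, sq_abs, div_pow]
    have e3 : n * (t ^ 2 / B n ^ 2) ≤ t ^ 2 / c' := by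
      rw [← mul_div_assoc, div_le_div_iff₀ (by positivity) hc']
      nlinarith [sq_nonneg t]
    calc (n : ℝ) * (∫ y, Real.sin (t / B n * y) ∂μ) ^ 2 ≤ n * (C * |t / B n| ^ 3) := by gcongr
      _ = C * (n * (t ^ 2 / B n ^ 2)) * |t / B n| := by rw [e2]; ring
      _ ≤ C * (t ^ 2 / c') * |t / B n| := by gcongr
      _ = C * t ^ 2 / c' * |t / B n| := by ring
  have := ((hnorm.add hr2).add him).div_const 2
  simp only [add_zero] at this
  refine this.congr fun n => ?_
  rw [norm_charFun_sq]
  ring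

/-- The Laplace transform of `n Y² / Bₙ²`, through the Gaussian average of `1 - Re φ`. -/
lemma tendsto_laplace_sq {c s₁ : ℝ} (hc : 0 < c) (hs₁ : 0 < s₁)
    (hs : ∀ s : ℝ, |s| ≤ s₁ →
      c * s ^ 2 ≤ cosDefect μ s ∧ cosDefect μ s ≤ 1 - ‖charFun μ s‖ ^ 2)
    (H1 : ∀ t : ℝ, Tendsto (fun n : ℕ => ‖charFun μ (t / B n)‖ ^ n) atTop
      (𝓝 (Real.exp (-(t ^ 2 / 2)))))
    {C : ℝ} (HC : ∀ s : ℝ, |s| ≤ 1 → (∫ y, Real.sin (s * y) ∂μ) ^ 2 ≤ C * |s| ^ 3)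
    {l : ℝ} (hl : 0 ≤ l) :
    Tendsto (fun n : ℕ => (∫ y, Real.exp (-(l * (y / B n) ^ 2)) ∂μ) ^ n) atTop
      (𝓝 (Real.exp (-l))) := by
  have hsq : Integrable (fun g : ℝ => g ^ 2) (gaussianReal 0 1) :=
    (memLp_id_gaussianReal 2).integrable_sq
  -- The scale √(2l) is chosen so that a standard Gaussian g satisfies E cos(√(2l) g x) = exp(-l
  -- x²).
  have hlim : Tendsto (fun n : ℕ => ∫ g, n * cosDefect μ (Real.sqrt (2 * l) * g / B n)
      ∂(gaussianReal 0 1)) atTop (𝓝 (∫ g, (Real.sqrt (2 * l) * g) ^ 2 / 2 ∂(gaussianReal 0 1))) := by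
    refine tendsto_integral_filter_of_dominated_convergence
      (fun g => 1 + 4 / δ ^ 2 * (Real.sqrt (2 * l) * g) ^ 2) ?_ ?_ ?_ ?_
    · refine Eventually.of_forall fun n => ?_
      have : StronglyMeasurable (fun g : ℝ => cosDefect μ (Real.sqrt (2 * l) * g / B n)) := by
        unfold cosDefect
        refine StronglyMeasurable.integral_prod_right'
          (f := fun p : ℝ × ℝ => 1 - Real.cos (Real.sqrt (2 * l) * p.1 / B n * p.2)) ?_
        exact Continuous.stronglyMeasurable (by fun_prop)
      exact (this.const_mul _).aestronglyMeasurable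
    · filter_upwards [eventually_nat_mul_cosDefect_le hB hδ H2 hc hs₁ hs] with n hn
      refine ae_of_all _ fun g => ?_
      rw [Real.norm_eq_abs, abs_of_nonneg (mul_nonneg (Nat.cast_nonneg n) (cosDefect_nonneg _ _))]
      exact hn _
    · refine (integrable_const _).add (Integrable.const_mul ?_ _)
      simp only [mul_pow]
      exact hsq.const_mul _
    · exact ae_of_all _ fun g => tendsto_nat_mul_cosDefect hB hδ H2 hc hs₁ hs H1 HC _
  have hval : ∫ g, (Real.sqrt (2 * l) * g) ^ 2 / 2 ∂(gaussianReal 0 1) = l := by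
    have h1 : ∫ g, g ^ 2 ∂(gaussianReal 0 1) = 1 := by
      have := variance_fun_id_gaussianReal (μ := 0) (v := 1)
      rw [variance_eq_integral (by fun_prop)] at this
      simpa using this
    have h2 : ∀ g : ℝ, (Real.sqrt (2 * l) * g) ^ 2 / 2 = l * g ^ 2 := fun g => by
      rw [mul_pow, Real.sq_sqrt (by positivity)]; ring
    simp only [h2]
    rw [integral_const_mul, h1, mul_one]
  rw [hval] at hlim
  have hcos : ∀ a : ℝ, ∫ g, (1 - Real.cos (a * g)) ∂(gaussianReal 0 1)
      = 1 - Real.exp (-(a ^ 2 / 2)) := by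
    intro a
    have h1 := charFun_gaussianReal (μ := 0) (v := 1) a
    have hint : Integrable (fun y : ℝ => Complex.exp (a * y * Complex.I)) (gaussianReal 0 1) := by
      refine Integrable.of_bound (C := 1) (by fun_prop) (ae_of_all _ fun y => ?_)
      rw [← Complex.ofReal_mul, Complex.norm_exp_ofReal_mul_I]
    have h2 : ∫ g, Real.cos (a * g) ∂(gaussianReal 0 1) = Real.exp (-(a ^ 2 / 2)) := by
      have h3 := congrArg Complex.re h1
      rw [charFun_apply_real, ← RCLike.re_eq_complex_re, ← integral_re hint] at h3
      have h4 : Complex.exp (a * ((0 : ℝ) : ℂ) * Complex.I - ((1 : NNReal) : ℂ) * (a : ℂ) ^ 2 / 2)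
          = ((Real.exp (-(a ^ 2 / 2)) : ℝ) : ℂ) := by
        push_cast
        congr 1
        simp
      rw [RCLike.re_eq_complex_re, h4, Complex.ofReal_re] at h3
      rw [← h3]
      refine integral_congr_ae (ae_of_all _ fun y => ?_)
      simp only
      rw [← Complex.ofReal_mul, Complex.exp_ofReal_mul_I_re]
    rw [integral_sub (integrable_const _), h2]
    · simp
    · exact Integrable.of_bound (C := 1) (by fun_prop) (ae_of_all _ fun y => Real.abs_cos_le_one _)
  have hfub : ∀ n : ℕ, ∫ g, cosDefect μ (Real.sqrt (2 * l) * g / B n) ∂(gaussianReal 0 1)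
      = 1 - ∫ y, Real.exp (-(l * (y / B n) ^ 2)) ∂μ := by
    intro n
    unfold cosDefect
    rw [integral_integral_swap]
    · have e : ∀ y : ℝ, ∫ g, (1 - Real.cos (Real.sqrt (2 * l) * g / B n * y)) ∂(gaussianReal 0 1)
          = 1 - Real.exp (-(l * (y / B n) ^ 2)) := by
        intro y
        have e1 := hcos (Real.sqrt (2 * l) / B n * y)
        have e2 : (Real.sqrt (2 * l) / B n * y) ^ 2 / 2 = l * (y / B n) ^ 2 := by
          rw [mul_pow, div_pow, Real.sq_sqrt (by positivity)]; ring
        rw [e2] at e1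
        rw [← e1]
        refine integral_congr_ae (ae_of_all _ fun g => ?_)
        simp only
        congr 2
        ring
      simp only [e]
      rw [integral_sub (integrable_const _)]
      · simp
      · refine Integrable.of_bound (C := 1) (by fun_prop) (ae_of_all _ fun y => ?_)
        rw [Real.norm_eq_abs, Real.abs_exp]
        exact Real.exp_le_one_iff.2 (by simp only [Left.neg_nonpos_iff]; positivity)
    · refine Integrable.of_bound (C := 2)
        (Continuous.aestronglyMeasurable (by fun_prop)) (ae_of_all _ fun p => ?_)
      simp only [Function.uncurry]
      rw [Real.norm_eq_abs, abs_le]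
      constructor <;> linarith [Real.cos_le_one (Real.sqrt (2 * l) * p.1 / B n * p.2),
        Real.neg_one_le_cos (Real.sqrt (2 * l) * p.1 / B n * p.2)]
  -- By Fubini, n times the deficit of the Laplace transform from 1 tends to l; its n-th power then
  -- tends to exp(-l).
  have hexp := Real.tendsto_one_add_pow_exp_of_tendsto (t := -l)
    (g := fun n => (∫ y, Real.exp (-(l * (y / B n) ^ 2)) ∂μ) - 1) (by
      refine hlim.neg.congr fun n => ?_
      rw [integral_const_mul, hfub]
      ring)
  simpa using hexp

end Norming

/-! ### Convergence in measure to constants. -/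

section ConvergenceInMeasure

variable {Ω E F : Type*} [MeasurableSpace Ω] {P : Measure Ω} [PseudoMetricSpace E]
  [PseudoMetricSpace F]

/-- Continuous mapping theorem for convergence in measure to a constant. -/
lemma tendstoInMeasure_comp_continuousAt {f : ℕ → Ω → E} {c : E} {g : E → F}
    (hf : TendstoInMeasure P f atTop (fun _ => c)) (hg : ContinuousAt g c) :
    TendstoInMeasure P (fun n ω => g (f n ω)) atTop (fun _ => g c) := by
  rw [tendstoInMeasure_iff_dist] at hf ⊢
  intro ε hε
  obtain ⟨δ, hδ, H⟩ := Metric.continuousAt_iff.1 hg ε hε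
  refine tendsto_of_tendsto_of_tendsto_of_le_of_le tendsto_const_nhds (hf δ hδ)
    (fun _ => zero_le) fun n => measure_mono fun ω hω => ?_
  by_contra hcon
  exact absurd (H (not_le.1 hcon)) (not_lt.2 hω)

lemma tendstoInMeasure_prodMk {f : ℕ → Ω → E} {g : ℕ → Ω → F} {c : E} {d : F}
    (hf : TendstoInMeasure P f atTop (fun _ => c)) (hg : TendstoInMeasure P g atTop (fun _ => d)) :
    TendstoInMeasure P (fun n ω => (f n ω, g n ω)) atTop (fun _ => (c, d)) := by
  rw [tendstoInMeasure_iff_dist] at hf hg ⊢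
  intro ε hε
  refine tendsto_of_tendsto_of_tendsto_of_le_of_le tendsto_const_nhds
    (by simpa using (hf ε hε).add (hg ε hε))
    (fun _ => zero_le) fun n => ?_
  refine (measure_mono fun ω hω => ?_).trans (measure_union_le _ _)
  simpa [Prod.dist_eq] using hω

lemma tendstoInMeasure_comp₂ {G : Type*} [PseudoMetricSpace G] {f : ℕ → Ω → E} {g : ℕ → Ω → F}
    {c : E} {d : F} (hf : TendstoInMeasure P f atTop (fun _ => c))
    (hg : TendstoInMeasure P g atTop (fun _ => d)) (φ : E → F → G)
    (hφ : Continuous (Function.uncurry φ)) :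
    TendstoInMeasure P (fun n ω => φ (f n ω) (g n ω)) atTop (fun _ => φ c d) :=
  tendstoInMeasure_comp_continuousAt (E := E × F) (c := (c, d)) (g := fun p => φ p.1 p.2)
    (tendstoInMeasure_prodMk hf hg) hφ.continuousAt

lemma tendstoInMeasure_const_of_tendsto {a : ℕ → E} {c : E} (h : Tendsto a atTop (𝓝 c)) :
    TendstoInMeasure P (fun n _ => a n) atTop (fun _ => c) := by
  rw [tendstoInMeasure_iff_dist]
  intro ε hε
  refine tendsto_const_nhds.congr' ?_
  filter_upwards [Metric.tendsto_nhds.1 h ε hε] with n hn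
  simp [not_le.2 hn]

lemma tendstoInMeasure_zero_of_abs_le {f g : ℕ → Ω → ℝ}
    (hg : TendstoInMeasure P g atTop (fun _ => 0)) (h : ∀ᶠ n in atTop, ∀ᵐ ω ∂P, |f n ω| ≤ g n ω) :
    TendstoInMeasure P f atTop (fun _ => 0) := by
  rw [tendstoInMeasure_iff_dist] at hg ⊢
  intro ε hε
  refine tendsto_of_tendsto_of_tendsto_of_le_of_le' tendsto_const_nhds (hg ε hε)
    (Eventually.of_forall fun _ => zero_le) ?_
  filter_upwards [h] with n hn
  refine measure_mono_ae ?_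
  filter_upwards [hn] with ω hω hω'
  have h1 : ε ≤ dist (f n ω) 0 := hω'
  change ε ≤ dist (g n ω) 0
  rw [Real.dist_eq, sub_zero] at h1 ⊢
  exact (h1.trans hω).trans (le_abs_self _)

/-- Markov's inequality. -/
lemma tendstoInMeasure_zero_of_integral [IsFiniteMeasure P] {f : ℕ → Ω → ℝ}
    (h0 : ∀ n ω, 0 ≤ f n ω) (hint : ∀ᶠ n in atTop, Integrable (f n) P)
    (h : Tendsto (fun n => ∫ ω, f n ω ∂P) atTop (𝓝 0)) :
    TendstoInMeasure P f atTop (fun _ => 0) := by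
  rw [tendstoInMeasure_iff_measureReal_dist]
  intro ε hε
  have h' := h.div_const ε
  rw [zero_div] at h'
  refine squeeze_zero' (Eventually.of_forall fun _ => measureReal_nonneg) ?_ h'
  filter_upwards [hint] with n hn
  rw [le_div_iff₀ hε, mul_comm]
  refine le_trans (le_of_eq ?_) (mul_meas_ge_le_integral_of_nonneg (ae_of_all _ (h0 n)) hn ε)
  congr 3
  ext ω
  simp [abs_of_nonneg (h0 n ω)]

end ConvergenceInMeasure

/-! ### Raikov's theorem. -/

section Raikov

variable {Ω : Type*} [MeasurableSpace Ω] {P : Measure Ω} {μ : Measure ℝ} {Y : ℕ → Ω → ℝ} (hY : ∀ i, Measurable (Y i))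
  (hind : iIndepFun Y P) (hlaw : ∀ i, P.map (Y i) = μ)

include hY hind hlaw

/-- Centering multiplies the characteristic function by a factor of modulus one, so no knowledge of
Aₙ is needed. -/
lemma norm_charFun_map_normalized_sum (n : ℕ) (a b t : ℝ) :
    ‖charFun (P.map fun ω => (∑ i ∈ Finset.range n, Y i ω - a) / b) t‖
      = ‖charFun μ (t / b)‖ ^ n := by
  have hS : Measurable fun ω => ∑ i ∈ Finset.range n, Y i ω := by fun_prop
  have e : (P.map fun ω => (∑ i ∈ Finset.range n, Y i ω - a) / b)
      = ((P.map fun ω => ∑ i ∈ Finset.range n, Y i ω).map (fun x => b⁻¹ * x)).map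
          (fun x => x + -(a / b)) := by
    rw [Measure.map_map (by fun_prop) (by fun_prop), Measure.map_map (by fun_prop) hS]
    congr 1
    ext ω
    simp only [Function.comp]
    ring
  have hsum : charFun (P.map fun ω => ∑ i ∈ Finset.range n, Y i ω) = charFun μ ^ n := by
    rw [iIndepFun.charFun_map_fun_finsetSum_eq_prod (fun i _ => (hY i).aemeasurable)
      (hind.restrict _)]
    simp [hlaw]
  rw [e, charFun_map_add_const, norm_mul, charFun_map_mul, hsum, Pi.pow_apply, norm_pow,
    show b⁻¹ * t = t / b by ring, Complex.norm_exp_ofReal_mul_I, mul_one]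

lemma integral_exp_neg_sum_sq (n : ℕ) (l b : ℝ) :
    ∫ ω, Real.exp (-(l * ((∑ i ∈ Finset.range n, Y i ω ^ 2) / b ^ 2))) ∂P
      = (∫ y, Real.exp (-(l * (y / b) ^ 2)) ∂μ) ^ n := by
  have h1 : ∀ ω, Real.exp (-(l * ((∑ i ∈ Finset.range n, Y i ω ^ 2) / b ^ 2)))
      = ∏ i : Fin n, Real.exp (-(l * (Y i ω / b) ^ 2)) := by
    intro ω
    rw [← Real.exp_sum, Finset.sum_range, Finset.sum_div, Finset.mul_sum, Finset.sum_neg_distrib]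
    simp only [div_pow]
  have hmeas : Measurable fun y : ℝ => Real.exp (-(l * (y / b) ^ 2)) := by fun_prop
  have hind' : iIndepFun (fun (i : Fin n) ω => Real.exp (-(l * (Y i ω / b) ^ 2))) P :=
    (hind.precomp (g := fun k : Fin n => (k : ℕ)) Fin.val_injective).comp
      (fun _ y => Real.exp (-(l * (y / b) ^ 2))) fun _ => hmeas
  simp only [h1]
  rw [hind'.integral_fun_prod_eq_prod_integral
    fun i => (hmeas.comp (hY i)).aestronglyMeasurable]
  have : ∀ i : Fin n, ∫ ω, Real.exp (-(l * (Y i ω / b) ^ 2)) ∂P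
      = ∫ y, Real.exp (-(l * (y / b) ^ 2)) ∂μ := by
    intro i
    rw [← hlaw i, integral_map (hY i).aemeasurable hmeas.aestronglyMeasurable]
  simp [this]

variable [IsProbabilityMeasure P]

/-- The bound has to be uniform over |t| ≤ δ for one large n. A single test function dominating 1 -
cos(tz) for all these t reduces it to weak convergence. -/
lemma exists_norm_charFun_lower_bound {A B : ℕ → ℝ} (hnorm : IsNormalNorming P Y A B) :
    ∃ δ : ℝ, 0 < δ ∧
      ∀ᶠ n in atTop, ∀ t : ℝ, |t| ≤ δ → 7 / 8 ≤ ‖charFun μ (t / B n)‖ ^ n := by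
  have hw := hnorm.2.tendsto
  -- For |t| ≤ 1/4, 1 - cos(tz) ≤ t²z²/2 ≤ z²/32; the cap 2 makes the function bounded. Its Gaussian
  -- mean is at most 1/32 < 1/8, and 1 - 1/8 = 7/8.
  let f : BoundedContinuousFunction ℝ ℝ := BoundedContinuousFunction.ofNormedAddCommGroup
    (fun z : ℝ => min 2 (z ^ 2 / 32)) (by fun_prop) 2 (fun z => by
      rw [Real.norm_eq_abs, abs_of_nonneg (by positivity)]; exact min_le_left _ _)
  have hf := ProbabilityMeasure.tendsto_iff_forall_integral_tendsto.1 hw f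
  simp only [ProbabilityMeasure.coe_mk, Measure.map_id] at hf
  have hlim : ∫ z, f z ∂(gaussianReal 0 1) < 1 / 8 := by
    have hsq : Integrable (fun g : ℝ => g ^ 2) (gaussianReal 0 1) :=
      (memLp_id_gaussianReal 2).integrable_sq
    have h1 : ∫ g, g ^ 2 ∂(gaussianReal 0 1) = 1 := by
      have := variance_fun_id_gaussianReal (μ := 0) (v := 1)
      rw [variance_eq_integral (by fun_prop)] at this
      simpa using this
    calc ∫ z, f z ∂(gaussianReal 0 1) ≤ ∫ z, z ^ 2 / 32 ∂(gaussianReal 0 1) := by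
          refine integral_mono (f.integrable _) (hsq.div_const _) fun z => min_le_right _ _
      _ < 1 / 8 := by rw [integral_div, h1]; norm_num
  refine ⟨1 / 4, by norm_num, ?_⟩
  filter_upwards [hf.eventually (gt_mem_nhds hlim)] with n hn t ht
  have hZ : AEMeasurable (fun ω => (∑ i ∈ Finset.range n, Y i ω - A n) / B n) P :=
    hnorm.2.forall_aemeasurable n
  have := Measure.isProbabilityMeasure_map hZ
  rw [← norm_charFun_map_normalized_sum hY hind hlaw n (A n) (B n) t]
  set ν := P.map fun ω => (∑ i ∈ Finset.range n, Y i ω - A n) / B n with hν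
  have h1 : cosDefect ν t ≤ ∫ z, f z ∂ν := by
    refine integral_mono (integrable_one_sub_cos ν t) (f.integrable _) fun z => ?_
    refine le_min (by linarith [Real.neg_one_le_cos (t * z)]) ?_
    have e1 := Real.one_sub_sq_div_two_le_cos (x := t * z)
    have e2 : t ^ 2 ≤ (1 / 4) ^ 2 := by rw [← sq_abs t]; gcongr
    simp only
    nlinarith [sq_nonneg z]
  have h2 := norm_charFun_sq ν t
  have h3 : cosDefect ν t < 1 / 8 := h1.trans_lt hn
  refine (abs_le_of_sq_le_sq' ?_ (norm_nonneg _)).2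
  nlinarith [sq_nonneg (∫ y, Real.sin (t * y) ∂ν)]

lemma tendsto_norm_charFun_pow {A B : ℕ → ℝ} (hnorm : IsNormalNorming P Y A B) (t : ℝ) :
    Tendsto (fun n : ℕ => ‖charFun μ (t / B n)‖ ^ n) atTop (𝓝 (Real.exp (-(t ^ 2 / 2)))) := by
  have h1 := (ProbabilityMeasure.tendsto_iff_tendsto_charFun.1 hnorm.2.tendsto t).norm
  simp only [ProbabilityMeasure.coe_mk, Measure.map_id] at h1
  rw [charFun_gaussianReal] at h1
  have h2 : Complex.exp (t * ((0 : ℝ) : ℂ) * Complex.I - ((1 : NNReal) : ℂ) * (t : ℂ) ^ 2 / 2)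
      = ((Real.exp (-(t ^ 2 / 2)) : ℝ) : ℂ) := by
    push_cast
    congr 1
    simp
  rw [h2, Complex.norm_real, Real.norm_eq_abs, Real.abs_exp] at h1
  refine h1.congr fun n => ?_
  exact norm_charFun_map_normalized_sum hY hind hlaw n (A n) (B n) t

variable [IsProbabilityMeasure μ]

/-- **Raikov's theorem**: if the normalized sums of a centred i.i.d. sequence are asymptotically
normal, then the sums of squares obey a weak law of large numbers with the squared norming
constants. -/
theorem tendstoInMeasure_sum_sq_div_sq_norming (h0 : Integrable (fun y : ℝ => y) μ)
    (h1 : Integrable (fun y : ℝ => |y| ^ (5 / 3 : ℝ)) μ) (hmean : ∫ y, y ∂μ = 0)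
    {A B : ℕ → ℝ} (hnorm : IsNormalNorming P Y A B) :
    (∃ c : ℝ, 0 < c ∧ ∀ᶠ n : ℕ in atTop, c * n ≤ B n ^ 2) ∧
      TendstoInMeasure P (fun (n : ℕ) ω => (∑ i ∈ Finset.range n, Y i ω ^ 2) / B n ^ 2) atTop
        (fun _ => 1) := by
  have H1 := tendsto_norm_charFun_pow hY hind hlaw hnorm
  obtain ⟨δ, hδ, H2⟩ := exists_norm_charFun_lower_bound hY hind hlaw hnorm
  obtain ⟨c, s₁, hc, hs₁, hs⟩ :=
    exists_cosDefect_le μ (not_ae_eq_zero_of_tendsto_charFun H1) h0 h1 hmean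
  obtain ⟨C, -, HC⟩ := sq_integral_sin_le μ h0 h1 hmean
  refine ⟨exists_nat_le_sq_norming hnorm.1 hδ H2 hc hs₁ hs, ?_⟩
  set Q : ℕ → Ω → ℝ := fun n ω => (∑ i ∈ Finset.range n, Y i ω ^ 2) / B n ^ 2 with hQ
  have hQm : ∀ n, Measurable (Q n) := fun n => by
    have : Measurable fun ω => ∑ i ∈ Finset.range n, Y i ω ^ 2 := by fun_prop
    exact this.div_const _
  have hQ0 : ∀ n ω, 0 ≤ Q n ω := fun n ω => by positivity
  have hL : ∀ l : ℝ, 0 ≤ l → Tendsto (fun n => ∫ ω, Real.exp (-(l * Q n ω)) ∂P) atTop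
      (𝓝 (Real.exp (-l))) := fun l hl => by
    refine (tendsto_laplace_sq hnorm.1 hδ H2 hc hs₁ hs H1 HC hl).congr fun n => ?_
    exact (integral_exp_neg_sum_sq hY hind hlaw n l (B n)).symm
  have hI : ∀ l : ℝ, 0 ≤ l → ∀ n, Integrable (fun ω => Real.exp (-(l * Q n ω))) P := by
    intro l hl n
    refine Integrable.of_bound (C := 1)
      ((hQm n).const_mul l).neg.exp.aestronglyMeasurable (ae_of_all _ fun ω => ?_)
    rw [Real.norm_eq_abs, Real.abs_exp]
    exact Real.exp_le_one_iff.2 (by simpa using mul_nonneg hl (hQ0 n ω))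
  -- The Laplace transforms at 1 and 2 alone suffice: E (exp(-Q) - e⁻¹)² → e⁻² - 2e⁻² + e⁻² = 0, and
  -- applying -log to exp(-Q) recovers Q.
  set e := Real.exp (-1) with he
  have hexpand : ∀ n ω, (Real.exp (-(1 * Q n ω)) - e) ^ 2
      = Real.exp (-(2 * Q n ω)) - 2 * e * Real.exp (-(1 * Q n ω)) + e ^ 2 := by
    intro n ω
    have : Real.exp (-(2 * Q n ω)) = Real.exp (-(1 * Q n ω)) ^ 2 := by
      rw [← Real.exp_nat_mul]; congr 1; push_cast; ring
    rw [this]; ring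
  have hsq : TendstoInMeasure P (fun n ω => (Real.exp (-(1 * Q n ω)) - e) ^ 2) atTop
      (fun _ => 0) := by
    refine tendstoInMeasure_zero_of_integral (fun n ω => sq_nonneg _)
      (Eventually.of_forall fun n => ?_) ?_
    · simp only [hexpand]
      exact ((hI 2 (by norm_num) n).sub ((hI 1 (by norm_num) n).const_mul _)).add
        (integrable_const _)
    · simp only [hexpand]
      have hlim := ((hL 2 (by norm_num)).sub ((hL 1 (by norm_num)).const_mul (2 * e))).add_const
        (e ^ 2)
      have hz : Real.exp (-2) - 2 * e * Real.exp (-1) + e ^ 2 = 0 := by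
        have : Real.exp (-2) = e ^ 2 := by rw [he, ← Real.exp_nat_mul]; norm_num
        rw [this, ← he]; ring
      rw [hz] at hlim
      refine hlim.congr fun n => ?_
      have e2 := integral_sub (hI 2 (by norm_num) n) ((hI 1 (by norm_num) n).const_mul (2 * e))
      have e1 := integral_add ((hI 2 (by norm_num) n).sub
        ((hI 1 (by norm_num) n).const_mul (2 * e))) (integrable_const (e ^ 2))
      simp only [Pi.sub_apply] at e1
      rw [e1, e2, integral_const_mul]
      simp
  have hexp : TendstoInMeasure P (fun n ω => Real.exp (-(1 * Q n ω))) atTop (fun _ => e) := by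
    have h2 := tendstoInMeasure_comp_continuousAt hsq Real.continuous_sqrt.continuousAt
    rw [tendstoInMeasure_iff_dist] at h2 ⊢
    intro ε hε
    refine (h2 ε hε).congr fun n => ?_
    simp [Real.dist_eq, Real.sqrt_sq_eq_abs]
  have hlog := tendstoInMeasure_comp_continuousAt hexp
    (Real.continuousAt_log (Real.exp_pos (-1)).ne').neg
  simpa [he] using hlog

end Raikov

/-! ### Counting tuples, and the algebra of the jackknife. -/

/-- Strictly increasing `m`-tuples with entries in `S`. -/
def tuples (m : ℕ) (S : Finset ℕ) : Finset (Fin m → ℕ) :=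
  (Fintype.piFinset fun _ : Fin m => S).filter StrictMono

/-- Strictly increasing `m`-tuples with entries below `n`, one of which is `i`. -/
def tuplesThrough (m n i : ℕ) : Finset (Fin m → ℕ) :=
  (tuples m (Finset.range n)).filter fun j => ∃ k, j k = i

lemma mem_tuples {m : ℕ} {S : Finset ℕ} {j : Fin m → ℕ} :
    j ∈ tuples m S ↔ (∀ k, j k ∈ S) ∧ StrictMono j := by
  simp [tuples]

lemma mem_tuplesThrough {m n i : ℕ} {j : Fin m → ℕ} :
    j ∈ tuplesThrough m n i ↔ ((∀ k, j k < n) ∧ StrictMono j) ∧ ∃ k, j k = i := by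
  simp [tuplesThrough, mem_tuples]

/-- An increasing tuple is determined by its range, an m-element subset of S. -/
lemma card_tuples (m : ℕ) (S : Finset ℕ) : (tuples m S).card = S.card.choose m := by
  rw [← Finset.card_powersetCard]
  refine Finset.card_bij (fun j _ => Finset.univ.image j) ?_ ?_ ?_
  · intro j hj
    rw [mem_tuples] at hj
    rw [Finset.mem_powersetCard]
    refine ⟨fun a ha => ?_, ?_⟩
    · obtain ⟨k, -, rfl⟩ := Finset.mem_image.1 ha
      exact hj.1 k
    · rw [Finset.card_image_of_injective _ hj.2.injective, Finset.card_univ, Fintype.card_fin]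
  · intro j hj j' hj' heq
    rw [mem_tuples] at hj hj'
    refine (hj.2.range_inj hj'.2).1 ?_
    simpa using congrArg (fun s : Finset ℕ => (s : Set ℕ)) heq
  · intro A hA
    rw [Finset.mem_powersetCard] at hA
    refine ⟨A.orderEmbOfFin hA.2, ?_, ?_⟩
    · rw [mem_tuples]
      exact ⟨fun k => hA.1 (A.orderEmbOfFin_mem hA.2 k), (A.orderEmbOfFin hA.2).strictMono⟩
    · ext a
      simp

lemma tuples_erase (m : ℕ) (S : Finset ℕ) (i : ℕ) :
    tuples m (S.erase i) = (tuples m S).filter fun j => ¬ ∃ k, j k = i := by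
  ext j
  simp only [mem_tuples, Finset.mem_erase, Finset.mem_filter, not_exists]
  constructor
  · rintro ⟨h1, h2⟩
    exact ⟨⟨fun k => (h1 k).2, h2⟩, fun k => (h1 k).1⟩
  · rintro ⟨⟨h1, h2⟩, h3⟩
    exact ⟨fun k => ⟨h3 k, h1 k⟩, h2⟩

lemma card_tuplesThrough {m n i : ℕ} (hm : 1 ≤ m) (hi : i < n) :
    (tuplesThrough m n i).card = (n - 1).choose (m - 1) := by
  have h := Finset.card_filter_add_card_filter_not (s := tuples m (Finset.range n))
    (fun j => ∃ k, j k = i)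
  rw [← tuples_erase, card_tuples, card_tuples, Finset.card_erase_of_mem (Finset.mem_range.2 hi),
    Finset.card_range] at h
  obtain ⟨n, rfl⟩ : ∃ n', n = n' + 1 := ⟨n - 1, by omega⟩
  obtain ⟨m, rfl⟩ : ∃ m', m = m' + 1 := ⟨m - 1, by omega⟩
  rw [Nat.choose_succ_succ'] at h
  simp only [Nat.add_sub_cancel] at h ⊢
  unfold tuplesThrough
  omega

/-- The count is C(n-2, m-2) for m ≥ 2. The product form also covers m = 1, where both sides vanish
but truncated subtraction would turn that binomial into 1. -/
lemma card_tuplesThrough_filter_mul {m n i l : ℕ} (hm : 1 ≤ m) (hmn : m ≤ n) (hi : i < n)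
    (hl : l < n) (hil : i ≠ l) :
    ((tuplesThrough m n i).filter fun j => ∃ k, j k = l).card * (n - 1)
      = (n - 1).choose (m - 1) * (m - 1) := by
  have h := Finset.card_filter_add_card_filter_not (s := tuplesThrough m n i)
    (fun j => ∃ k, j k = l)
  have h2 : ((tuplesThrough m n i).filter fun j => ¬ ∃ k, j k = l).card
      = (n - 1 - 1).choose (m - 1) := by
    have h3 := Finset.card_filter_add_card_filter_not (s := tuples m ((Finset.range n).erase l))
      (fun j => ∃ k, j k = i)
    rw [← tuples_erase, card_tuples, card_tuples, Finset.card_erase_of_mem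
      (Finset.mem_erase.2 ⟨hil, Finset.mem_range.2 hi⟩),
      Finset.card_erase_of_mem (Finset.mem_range.2 hl), Finset.card_range] at h3
    have h4 : (tuplesThrough m n i).filter (fun j => ¬ ∃ k, j k = l)
        = (tuples m ((Finset.range n).erase l)).filter fun j => ∃ k, j k = i := by
      rw [tuples_erase, tuplesThrough, Finset.filter_comm]
    rw [h4]
    obtain ⟨n, rfl⟩ : ∃ n', n = n' + 2 := ⟨n - 2, by omega⟩
    obtain ⟨m, rfl⟩ : ∃ m', m = m' + 1 := ⟨m - 1, by omega⟩
    simp only [Nat.add_sub_cancel, show n + 2 - 1 = n + 1 by omega] at h3 ⊢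
    rw [Nat.choose_succ_succ'] at h3
    omega
  rw [h2, card_tuplesThrough hm hi] at h
  obtain ⟨n, rfl⟩ : ∃ n', n = n' + 2 := ⟨n - 2, by omega⟩
  simp only [Nat.add_sub_cancel, show n + 2 - 1 = n + 1 by omega] at h ⊢
  have h5 := Nat.choose_mul_succ_eq n (m - 1)
  zify at h h5 ⊢
  rw [Nat.cast_sub (by omega : m - 1 ≤ n + 1)] at h5
  push_cast at h5
  linear_combination (n + 1 : ℤ) * h - h5

/-- The average of the kernel over all increasing tuples below `n` that contain the index `i`. -/
noncomputable def throughAvg {m : ℕ} (h : (Fin m → ℝ) → ℝ) (n i : ℕ) (x : ℕ → ℝ) : ℝ :=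
  (((n - 1).choose (m - 1) : ℕ) : ℝ)⁻¹ * ∑ j ∈ tuplesThrough m n i, h (fun k => x (j k))

lemma throughAvg_add {m : ℕ} (g₁ g₂ : (Fin m → ℝ) → ℝ) (n i : ℕ) (x : ℕ → ℝ) :
    throughAvg (fun y => g₁ y + g₂ y) n i x = throughAvg g₁ n i x + throughAvg g₂ n i x := by
  simp only [throughAvg, Finset.sum_add_distrib, mul_add]

/-- Splitting tuples by whether they contain i gives n Uₙ = m Vᵢ + (n - m) Uⁱₙ₋₁. -/
lemma uStatJack_sub_uStatN {m : ℕ} (hm : 1 ≤ m) (h : (Fin m → ℝ) → ℝ) {n i : ℕ} (hn : m < n)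
    (hi : i < n) (x : ℕ → ℝ) :
    uStatJack h n i x - uStatN h n x
      = m / ((n : ℝ) - m) * (uStatN h n x - throughAvg h n i x) := by
  have hsplit := Finset.sum_filter_add_sum_filter_not (tuples m (Finset.range n))
    (fun j => ∃ k, j k = i) (fun j => h (fun k => x (j k)))
  have hJ : uStatJack h n i x = (((n - 1).choose m : ℕ) : ℝ)⁻¹
      * ∑ j ∈ (tuples m (Finset.range n)).filter (fun j => ¬ ∃ k, j k = i), h (fun k => x (j k)) := by
    rw [← tuples_erase, uStatJack, uStat, Finset.card_erase_of_mem (Finset.mem_range.2 hi),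
      Finset.card_range]
    rfl
  have hU : uStatN h n x = ((n.choose m : ℕ) : ℝ)⁻¹
      * ∑ j ∈ tuples m (Finset.range n), h (fun k => x (j k)) := by
    rw [uStatN, uStat, Finset.card_range]
    rfl
  rw [hJ, hU, throughAvg, tuplesThrough, ← hsplit]
  set W := ∑ j ∈ (tuples m (Finset.range n)).filter (fun j => ∃ k, j k = i), h (fun k => x (j k))
  set V := ∑ j ∈ (tuples m (Finset.range n)).filter (fun j => ¬ ∃ k, j k = i),
    h (fun k => x (j k))
  obtain ⟨N, rfl⟩ : ∃ N, n = N + 1 := ⟨n - 1, by omega⟩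
  obtain ⟨p, rfl⟩ : ∃ p, m = p + 1 := ⟨m - 1, by omega⟩
  simp only [Nat.add_sub_cancel]
  have c1 : ((N + 1).choose (p + 1) : ℝ) * (p + 1) = (N + 1) * N.choose p := by
    exact_mod_cast (Nat.add_one_mul_choose_eq N p).symm
  have c2 : ((N + 1).choose (p + 1) : ℝ) = N.choose p + N.choose (p + 1) := by
    exact_mod_cast Nat.choose_succ_succ N p
  have p1 : (0 : ℝ) < N.choose p := by exact_mod_cast Nat.choose_pos (by omega)
  have p2 : (0 : ℝ) < N.choose (p + 1) := by exact_mod_cast Nat.choose_pos (by omega)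
  have p3 : (0 : ℝ) < (N : ℝ) - p := by
    have : (p : ℝ) < N := by exact_mod_cast (by omega : p < N)
    linarith
  have c3 : (N.choose (p + 1) : ℝ) * (p + 1) = N.choose p * (N - p) := by
    rw [c2] at c1; linarith
  have c4 : (N.choose (p + 1) : ℝ) = N.choose p * (N - p) / (p + 1) := by
    rw [eq_div_iff (by positivity)]; exact c3
  rw [c2, c4]
  have : (0 : ℝ) < (N : ℝ) + 1 := by positivity
  push_cast
  have e : (N : ℝ) + 1 - (p + 1) = N - p := by ring
  rw [e]
  have e2 : (N.choose p : ℝ) + N.choose p * (N - p) / (p + 1) = N.choose p * (N + 1) / (p + 1) := by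
    field_simp; ring
  rw [e2]
  field_simp
  ring

/-- Double counting: each tuple is met once for each of its m entries. -/
lemma sum_throughAvg {m : ℕ} (hm : 1 ≤ m) (h : (Fin m → ℝ) → ℝ) {n : ℕ} (hn : m < n)
    (x : ℕ → ℝ) : ∑ i ∈ Finset.range n, throughAvg h n i x = n * uStatN h n x := by
  have hU : uStatN h n x = ((n.choose m : ℕ) : ℝ)⁻¹
      * ∑ j ∈ tuples m (Finset.range n), h (fun k => x (j k)) := by
    rw [uStatN, uStat, Finset.card_range]
    rfl
  have hW : ∑ i ∈ Finset.range n, ∑ j ∈ tuplesThrough m n i, h (fun k => x (j k))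
      = m * ∑ j ∈ tuples m (Finset.range n), h (fun k => x (j k)) := by
    simp only [tuplesThrough, Finset.sum_filter]
    rw [Finset.sum_comm, Finset.mul_sum]
    refine Finset.sum_congr rfl fun j hj => ?_
    rw [mem_tuples] at hj
    rw [← Finset.sum_filter, Finset.sum_const, nsmul_eq_mul]
    congr 2
    have : (Finset.range n).filter (fun i => ∃ k, j k = i) = Finset.univ.image j := by
      ext a
      simp only [Finset.mem_filter, Finset.mem_image, Finset.mem_univ, true_and]
      exact ⟨fun h => h.2, fun ⟨k, hk⟩ => ⟨hk ▸ hj.1 k, k, hk⟩⟩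
    rw [this, Finset.card_image_of_injective _ hj.2.injective, Finset.card_univ, Fintype.card_fin]
  simp only [throughAvg]
  rw [← Finset.mul_sum, hW, hU]
  obtain ⟨N, rfl⟩ : ∃ N, n = N + 1 := ⟨n - 1, by omega⟩
  obtain ⟨p, rfl⟩ : ∃ p, m = p + 1 := ⟨m - 1, by omega⟩
  simp only [Nat.add_sub_cancel]
  have c1 : ((N + 1).choose (p + 1) : ℝ) * (p + 1) = (N + 1) * N.choose p := by
    exact_mod_cast (Nat.add_one_mul_choose_eq N p).symm
  have p1 : (0 : ℝ) < N.choose p := by exact_mod_cast Nat.choose_pos (by omega)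
  have p2 : (0 : ℝ) < (N + 1).choose (p + 1) := by exact_mod_cast Nat.choose_pos (by omega)
  push_cast
  field_simp
  linear_combination (∑ j ∈ tuples (p + 1) (Finset.range (N + 1)), h (fun k => x (j k))) * c1

lemma jackVar_eq {m : ℕ} (hm : 1 ≤ m) (h : (Fin m → ℝ) → ℝ) {n : ℕ} (hn : m < n)
    (x : ℕ → ℝ) :
    jackVar h n x = ((n : ℝ) - 1) * (m / ((n : ℝ) - m)) ^ 2 *
      ∑ i ∈ Finset.range n, (throughAvg h n i x - uStatN h n x) ^ 2 := by
  rw [jackVar, mul_assoc, Finset.mul_sum (Finset.range n) _ ((m / ((n : ℝ) - m)) ^ 2)]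
  congr 1
  refine Finset.sum_congr rfl fun i hi => ?_
  rw [uStatJack_sub_uStatN hm h hn (Finset.mem_range.1 hi)]
  ring

/-- Decomposition of the jackknife sum of squares along arbitrary approximations `y i` of the
centred averages. -/
lemma sum_throughAvg_sub_sq {m : ℕ} (hm : 1 ≤ m) (h : (Fin m → ℝ) → ℝ) {n : ℕ} (hn : m < n)
    (x y : ℕ → ℝ) (θ : ℝ) :
    ∑ i ∈ Finset.range n, (throughAvg h n i x - uStatN h n x) ^ 2
      = ∑ i ∈ Finset.range n, y i ^ 2
        + 2 * ∑ i ∈ Finset.range n, y i * (throughAvg h n i x - θ - y i)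
        + ∑ i ∈ Finset.range n, (throughAvg h n i x - θ - y i) ^ 2
        - n * ((∑ i ∈ Finset.range n, y i
          + ∑ i ∈ Finset.range n, (throughAvg h n i x - θ - y i)) / n) ^ 2 := by
  have hn0 : (n : ℝ) ≠ 0 := by
    have : 0 < n := by omega
    positivity
  have h1 := sum_throughAvg hm h hn x
  have h2 : (∑ i ∈ Finset.range n, y i
      + ∑ i ∈ Finset.range n, (throughAvg h n i x - θ - y i)) / n = uStatN h n x - θ := by
    rw [← Finset.sum_add_distrib, div_eq_iff hn0]
    simp only [add_sub_cancel]
    rw [Finset.sum_sub_distrib, h1]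
    simp
    ring
  -- The variance identity, valid because Uₙ is the mean of the averages.
  have h3 : ∑ i ∈ Finset.range n, (throughAvg h n i x - uStatN h n x) ^ 2
      = ∑ i ∈ Finset.range n, (throughAvg h n i x - θ) ^ 2 - n * (uStatN h n x - θ) ^ 2 := by
    have : ∀ i, (throughAvg h n i x - uStatN h n x) ^ 2
        = (throughAvg h n i x - θ) ^ 2 - 2 * (uStatN h n x - θ) * throughAvg h n i x
          + (uStatN h n x ^ 2 - θ ^ 2) := fun i => by ring
    simp only [this]
    rw [Finset.sum_add_distrib, Finset.sum_sub_distrib, ← Finset.mul_sum, h1]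
    simp
    ring
  rw [h2, h3, Finset.mul_sum, ← Finset.sum_add_distrib, ← Finset.sum_add_distrib]
  congr 1
  refine Finset.sum_congr rfl fun i _ => ?_
  ring

/-! ### The first projection of a kernel and its contraction properties. -/

section Projection

variable {m : ℕ} [NeZero m]

/-- The uncentred first projection `x ↦ E g(x, X₂, …, Xₘ)` of a kernel. -/
noncomputable def proj (F : Measure ℝ) (g : (Fin m → ℝ) → ℝ) (x : ℝ) : ℝ :=
  ∫ y, g (Function.update y 0 x) ∂(Measure.pi fun _ : Fin m => F)

variable (F : Measure ℝ) [IsProbabilityMeasure F] {g : (Fin m → ℝ) → ℝ}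

lemma measurable_proj (hg : Measurable g) : Measurable (proj F g) := by
  have : Measurable (fun p : ℝ × (Fin m → ℝ) => g (Function.update p.2 0 p.1)) :=
    hg.comp (measurePreserving_update F).measurable
  exact this.stronglyMeasurable.integral_prod_right'.measurable

lemma measurable_update_zero (x : ℝ) :
    Measurable fun y : Fin m → ℝ => Function.update y 0 x :=
  -- Only measurability is extracted; the Dirac mass is an arbitrary probability measure.
  (measurePreserving_update (m := m) (Measure.dirac (0 : ℝ))).measurable.comp
    (measurable_const.prodMk measurable_id)

lemma ae_integrable_update (hg : Integrable g (Measure.pi fun _ : Fin m => F)) :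
    ∀ᵐ x ∂F, Integrable (fun y => g (Function.update y 0 x)) (Measure.pi fun _ : Fin m => F) :=
  ((measurePreserving_update F).integrable_comp_of_integrable hg).prod_right_ae

lemma integral_integral_update (hg : Integrable g (Measure.pi fun _ : Fin m => F)) :
    ∫ x, ∫ y, g (Function.update y 0 x) ∂(Measure.pi fun _ : Fin m => F) ∂F
      = ∫ y, g y ∂(Measure.pi fun _ : Fin m => F) := by
  have hT := measurePreserving_update (m := m) F
  have hg' : AEStronglyMeasurable g ((F.prod (Measure.pi fun _ : Fin m => F)).map
      (fun p : ℝ × (Fin m → ℝ) => Function.update p.2 0 p.1)) := by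
    rw [hT.map_eq]; exact hg.aestronglyMeasurable
  conv_rhs => rw [← hT.map_eq]
  rw [integral_map hT.measurable.aemeasurable hg',
    integral_prod (fun p : ℝ × (Fin m → ℝ) => g (Function.update p.2 0 p.1))
      (hT.integrable_comp_of_integrable hg)]

lemma integrable_of_integrable_rpow_abs {Ω : Type*} [MeasurableSpace Ω] {P : Measure Ω}
    [IsFiniteMeasure P] {f : Ω → ℝ} {p : ℝ} (hp : 1 ≤ p) (hf : AEStronglyMeasurable f P)
    (h : Integrable (fun ω => |f ω| ^ p) P) : Integrable f P := by
  refine ((integrable_const (1 : ℝ)).add h).mono' hf (ae_of_all _ fun ω => ?_)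
  rw [Real.norm_eq_abs, Pi.add_apply]
  rcases le_total |f ω| 1 with h1 | h1
  · exact h1.trans (le_add_of_nonneg_right (by positivity))
  · have : |f ω| ≤ |f ω| ^ p := by
      conv_lhs => rw [← Real.rpow_one |f ω|]
      exact Real.rpow_le_rpow_of_exponent_le h1 hp
    linarith

/-- Jensen's inequality for x ↦ xᵖ. -/
lemma abs_integral_rpow_le {Ω : Type*} [MeasurableSpace Ω] {P : Measure Ω}
    [IsProbabilityMeasure P] {f : Ω → ℝ} {p : ℝ} (hp : 1 ≤ p) (hf : AEStronglyMeasurable f P)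
    (h : Integrable (fun ω => |f ω| ^ p) P) : |∫ ω, f ω ∂P| ^ p ≤ ∫ ω, |f ω| ^ p ∂P := by
  have hint := integrable_of_integrable_rpow_abs hp hf h
  calc |∫ ω, f ω ∂P| ^ p ≤ (∫ ω, |f ω| ∂P) ^ p := by
        gcongr; exact abs_integral_le_integral_abs
    _ ≤ ∫ ω, |f ω| ^ p ∂P :=
        (convexOn_rpow hp).map_integral_le
          (fun x _ => (Real.continuousAt_rpow_const x p (Or.inr (by linarith))).continuousWithinAt)
          isClosed_Ici (ae_of_all _ fun ω => abs_nonneg (f ω)) hint.abs h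

/-- Taking the first projection is a contraction in `Lᵖ`. -/
lemma integrable_proj_rpow_and_integral_le {p : ℝ} (hp : 1 ≤ p) (hg : Measurable g)
    (hint : Integrable (fun y => |g y| ^ p) (Measure.pi fun _ : Fin m => F)) :
    Integrable (fun x => |proj F g x| ^ p) F ∧
      ∫ x, |proj F g x| ^ p ∂F ≤ ∫ y, |g y| ^ p ∂(Measure.pi fun _ : Fin m => F) := by
  have hle : ∀ᵐ x ∂F, |proj F g x| ^ p
      ≤ ∫ y, |g (Function.update y 0 x)| ^ p ∂(Measure.pi fun _ : Fin m => F) := by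
    filter_upwards [ae_integrable_update F hint] with x hx
    exact abs_integral_rpow_le hp (hg.comp (measurable_update_zero x)).aestronglyMeasurable hx
  have hI : Integrable (fun x => ∫ y, |g (Function.update y 0 x)| ^ p
      ∂(Measure.pi fun _ : Fin m => F)) F :=
    ((measurePreserving_update F).integrable_comp_of_integrable hint).integral_prod_left
  have hI' : Integrable (fun x => |proj F g x| ^ p) F := by
    refine hI.mono' ?_ ?_
    · exact ((measurable_proj F hg).abs.pow_const p).aestronglyMeasurable
    · filter_upwards [hle] with x hx
      rwa [Real.norm_eq_abs, abs_of_nonneg (by positivity)]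
  refine ⟨hI', ?_⟩
  rw [← integral_integral_update F hint]
  exact integral_mono_ae hI' hI hle

lemma integrable_proj_sq_and_integral_le (hg : Measurable g)
    (hint : Integrable (fun y => g y ^ 2) (Measure.pi fun _ : Fin m => F)) :
    Integrable (fun x => proj F g x ^ 2) F ∧
      ∫ x, proj F g x ^ 2 ∂F ≤ ∫ y, g y ^ 2 ∂(Measure.pi fun _ : Fin m => F) := by
  have h2 : ∀ a : ℝ, |a| ^ (2 : ℝ) = a ^ 2 := fun a => by
    rw [Real.rpow_two, sq_abs]
  have := integrable_proj_rpow_and_integral_le F (p := 2) (by norm_num) hg (by simpa [h2] using hint)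
  simpa only [h2] using this

lemma integrable_proj_and_integral_abs_le (hg : Measurable g)
    (hint : Integrable g (Measure.pi fun _ : Fin m => F)) :
    Integrable (proj F g) F ∧
      ∫ x, |proj F g x| ∂F ≤ ∫ y, |g y| ∂(Measure.pi fun _ : Fin m => F) := by
  have := integrable_proj_rpow_and_integral_le F le_rfl hg (by simpa using hint.abs)
  simp only [Real.rpow_one] at this
  exact ⟨(integrable_norm_iff (measurable_proj F hg).aestronglyMeasurable).1 this.1, this.2⟩

end Projection

/-! ### Moments of the averages through i around their conditional means. -/

section Sample

variable {Ω : Type*} [MeasurableSpace Ω] {P : Measure Ω} [IsProbabilityMeasure P]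
  {F : Measure ℝ} {X : ℕ → Ω → ℝ} (hX : ∀ i, Measurable (X i))
  (hindep : iIndepFun X P) (hlaw : ∀ i, P.map (X i) = F) {m : ℕ}

include hX hindep hlaw

lemma map_tuple_eq_pi {j : Fin m → ℕ} (hj : Function.Injective j) :
    P.map (fun ω k => X (j k) ω) = Measure.pi fun _ : Fin m => F := by
  rw [(iIndepFun_iff_map_fun_eq_pi_map (f := fun k : Fin m => X (j k))
    (fun k => (hX _).aemeasurable)).1 (hindep.precomp (g := j) hj)]
  simp [hlaw]

lemma measurePreserving_tuple {j : Fin m → ℕ} (hj : Function.Injective j) :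
    MeasurePreserving (fun ω k => X (j k) ω) P (Measure.pi fun _ : Fin m => F) :=
  ⟨measurable_pi_lambda _ fun _ => hX _, map_tuple_eq_pi hX hindep hlaw hj⟩

variable [IsProbabilityMeasure F] [NeZero m] {g : (Fin m → ℝ) → ℝ}

/-- Given the observations in `T`, which share only the first index with the tuple `j`, the
kernel at `j` has conditional mean `proj F g (X i)`. -/
lemma integral_sub_proj_mul_eq_zero (hg : Measurable g) {C : ℝ} (hC : ∀ y, |g y| ≤ C)
    {j : Fin m → ℕ} (hj : Function.Injective j) {T : Finset ℕ} {i : ℕ} (hi : i ∈ T)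
    (hj0 : j 0 = i) (hjT : ∀ k, k ≠ 0 → j k ∉ T) {φ : (T → ℝ) → ℝ} (hφ : Measurable φ) {D : ℝ}
    (hD : ∀ z, |φ z| ≤ D) :
    ∫ ω, (g (fun k => X (j k) ω) - proj F g (X i ω)) * φ (fun t => X t ω) ∂P = 0 := by
  -- Slot 0 of j receives a fresh index l, so the new tuple is independent of the observations in T
  -- and has the full product law. Overwriting slot 0 by Xᵢ recovers the kernel at j, while
  -- integrating over the new tuple produces `proj F g`.
  obtain ⟨l, hl⟩ := Infinite.exists_notMem_finset (T ∪ Finset.univ.image j)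
  simp only [Finset.mem_union, Finset.mem_image, Finset.mem_univ, true_and, not_or,
    not_exists] at hl
  set j' : Fin m → ℕ := Function.update j 0 l with hj'
  have hj's : ∀ k, k ≠ 0 → j' k = j k := fun k hk => Function.update_of_ne hk _ _
  have hj'0 : j' 0 = l := Function.update_self _ _ _
  have hinj : Function.Injective j' := by
    intro a b hab
    by_cases ha : a = 0 <;> by_cases hb : b = 0
    · rw [ha, hb]
    · rw [ha, hj'0, hj's b hb] at hab; exact absurd hab.symm (hl.2 b)
    · rw [hb, hj'0, hj's a ha] at hab; exact absurd hab (hl.2 a)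
    · rw [hj's a ha, hj's b hb] at hab; exact hj hab
  have hdisj : Disjoint T (Finset.univ.image j') := by
    rw [Finset.disjoint_right]
    intro a ha
    obtain ⟨k, -, rfl⟩ := Finset.mem_image.1 ha
    by_cases hk : k = 0
    · rw [hk, hj'0]; exact hl.1
    · rw [hj's k hk]; exact hjT k hk
  have hXT : Measurable fun ω (t : T) => X t ω := measurable_pi_lambda _ fun t => hX _
  have hXj : Measurable fun ω (k : Fin m) => X (j' k) ω := measurable_pi_lambda _ fun k => hX _
  have hind : IndepFun (fun ω (t : T) => X t ω) (fun ω (k : Fin m) => X (j' k) ω) P := by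
    have h1 := hindep.indepFun_finset T (Finset.univ.image j') hdisj hX
    have h2 : Measurable fun (z : ↥(Finset.univ.image j') → ℝ) (k : Fin m) =>
        z ⟨j' k, Finset.mem_image_of_mem _ (Finset.mem_univ k)⟩ :=
      measurable_pi_lambda _ fun k => measurable_pi_apply _
    exact h1.comp measurable_id h2
  have hmap := (indepFun_iff_map_prod_eq_prod_map_map hXT.aemeasurable hXj.aemeasurable).1 hind
  rw [map_tuple_eq_pi hX hindep hlaw hinj] at hmap
  have := Measure.isProbabilityMeasure_map (μ := P) hXT.aemeasurable
  set ν := P.map fun ω (t : T) => X t ω with hν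
  let G : (T → ℝ) × (Fin m → ℝ) → ℝ := fun p =>
    (g (Function.update p.2 0 (p.1 ⟨i, hi⟩)) - proj F g (p.1 ⟨i, hi⟩)) * φ p.1
  have hev : Measurable fun p : (T → ℝ) × (Fin m → ℝ) => p.1 ⟨i, hi⟩ :=
    (measurable_pi_apply _).comp measurable_fst
  have hupd : Measurable fun p : (T → ℝ) × (Fin m → ℝ) =>
      g (Function.update p.2 0 (p.1 ⟨i, hi⟩)) :=
    (hg.comp (measurePreserving_update (m := m) F).measurable).comp
      (hev.prodMk measurable_snd)
  have hG : Measurable G :=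
    (hupd.sub ((measurable_proj F hg).comp hev)).mul (hφ.comp measurable_fst)
  have hprojC : ∀ x, |proj F g x| ≤ C := fun x => by
    have := norm_integral_le_of_norm_le_const (μ := Measure.pi fun _ : Fin m => F)
      (f := fun y => g (Function.update y 0 x)) (C := C) (ae_of_all _ fun y => hC _)
    simpa [proj] using this
  have hGint : Integrable G (ν.prod (Measure.pi fun _ : Fin m => F)) := by
    refine Integrable.of_bound (C := (C + C) * D) hG.aestronglyMeasurable (ae_of_all _ fun p => ?_)
    rw [Real.norm_eq_abs, abs_mul]
    have h1 := (abs_sub (g (Function.update p.2 0 (p.1 ⟨i, hi⟩)))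
      (proj F g (p.1 ⟨i, hi⟩))).trans (add_le_add (hC _) (hprojC _))
    exact mul_le_mul h1 (hD _) (abs_nonneg _) ((abs_nonneg _).trans h1)
  have heq : ∀ ω, (g (fun k => X (j k) ω) - proj F g (X i ω)) * φ (fun t => X t ω)
      = G (fun t => X t ω, fun k => X (j' k) ω) := by
    intro ω
    have : Function.update (fun k => X (j' k) ω) 0 (X i ω) = fun k => X (j k) ω := by
      ext k
      by_cases hk : k = 0
      · rw [hk, Function.update_self, hj0]
      · rw [Function.update_of_ne hk, hj's k hk]
    simp only [G, this]
  simp only [heq]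
  rw [← integral_map (φ := fun ω => ((fun t : T => X t ω), fun k : Fin m => X (j' k) ω))
    (hXT.prodMk hXj).aemeasurable hG.aestronglyMeasurable, hmap, integral_prod _ hGint]
  refine integral_eq_zero_of_ae (ae_of_all _ fun z => ?_)
  have hgi : Integrable (fun y => g (Function.update y 0 (z ⟨i, hi⟩)))
      (Measure.pi fun _ : Fin m => F) :=
    Integrable.of_bound (C := C) (hg.comp (measurable_update_zero _)).aestronglyMeasurable
      (ae_of_all _ fun y => hC _)
  simp only [G, Pi.zero_apply]
  rw [integral_mul_const, integral_sub hgi (integrable_const _)]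
  simp [proj]

variable (hsymm : ∀ (σ : Equiv.Perm (Fin m)) (y : Fin m → ℝ), g (fun k => y (σ k)) = g y)

include hsymm in
-- Condition on all observations entering j'. The tuple j meets them only in i, which symmetry moves
-- to slot 0, so the first factor has conditional mean zero.
lemma integral_sub_proj_mul_sub_proj_eq_zero (hg : Measurable g) {C : ℝ} (hC : ∀ y, |g y| ≤ C)
    {j j' : Fin m → ℕ} (hj : Function.Injective j) {i : ℕ} (hji : ∃ k, j k = i)
    (hj'i : ∃ k, j' k = i) (hdisj : ∀ k, j k ≠ i → ∀ k', j' k' ≠ j k) :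
    ∫ ω, (g (fun k => X (j k) ω) - proj F g (X i ω))
      * (g (fun k => X (j' k) ω) - proj F g (X i ω)) ∂P = 0 := by
  obtain ⟨k₀, hk₀⟩ := hji
  obtain ⟨k₁, hk₁⟩ := hj'i
  have hiT : i ∈ Finset.univ.image j' := Finset.mem_image.2 ⟨k₁, Finset.mem_univ _, hk₁⟩
  have hprojC : ∀ x, |proj F g x| ≤ C := fun x => by
    have := norm_integral_le_of_norm_le_const (μ := Measure.pi fun _ : Fin m => F)
      (f := fun y => g (Function.update y 0 x)) (C := C) (ae_of_all _ fun y => hC _)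
    simpa [proj] using this
  have hφ : Measurable fun z : ↥(Finset.univ.image j') → ℝ =>
      g (fun k => z ⟨j' k, Finset.mem_image_of_mem _ (Finset.mem_univ k)⟩)
        - proj F g (z ⟨i, hiT⟩) :=
    (hg.comp (measurable_pi_lambda _ fun k => measurable_pi_apply _)).sub
      ((measurable_proj F hg).comp
        (measurable_pi_apply (⟨i, hiT⟩ : ↥(Finset.univ.image j'))))
  have key := integral_sub_proj_mul_eq_zero hX hindep hlaw hg hC
    (j := fun k => j (Equiv.swap 0 k₀ k)) (hj.comp (Equiv.injective _))
    (T := Finset.univ.image j') (i := i) hiT (by simpa using hk₀) ?_ hφ (D := C + C) ?_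
  · rw [← key]
    refine integral_congr_ae (ae_of_all _ fun ω => ?_)
    simp only
    rw [hsymm (Equiv.swap 0 k₀) (fun k => X (j k) ω)]
  · intro k hk hmem
    obtain ⟨k', -, hk'⟩ := Finset.mem_image.1 hmem
    refine hdisj _ (fun h => hk ?_) k' hk'
    have h1 := hj (h.trans hk₀.symm)
    rw [Equiv.swap_apply_eq_iff] at h1
    simpa using h1
  · intro z
    exact (abs_sub _ _).trans (add_le_add (hC _) (hprojC _))

lemma integral_sub_proj_sq_le (hg : Measurable g) {C : ℝ} (hC : ∀ y, |g y| ≤ C)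
    {j : Fin m → ℕ} (hj : Function.Injective j) (i : ℕ) :
    ∫ ω, (g (fun k => X (j k) ω) - proj F g (X i ω)) ^ 2 ∂P
      ≤ 4 * ∫ y, g y ^ 2 ∂(Measure.pi fun _ : Fin m => F) := by
  have hC0 : ∀ y, g y ^ 2 ≤ C ^ 2 := fun y => by
    rw [← sq_abs]; exact pow_le_pow_left₀ (abs_nonneg _) (hC y) 2
  have hint : Integrable (fun y => g y ^ 2) (Measure.pi fun _ : Fin m => F) :=
    Integrable.of_bound (C := C ^ 2) (hg.pow_const 2).aestronglyMeasurable
      (ae_of_all _ fun y => by rw [Real.norm_eq_abs, abs_of_nonneg (sq_nonneg _)]; exact hC0 y)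
  have hp := integrable_proj_sq_and_integral_le F hg hint
  have hmp := measurePreserving_tuple hX hindep hlaw hj
  have hXi : MeasurePreserving (X i) P F := ⟨hX i, hlaw i⟩
  have i1 : Integrable (fun ω => g (fun k => X (j k) ω) ^ 2) P :=
    hmp.integrable_comp_of_integrable hint
  have i2 : Integrable (fun ω => proj F g (X i ω) ^ 2) P := hXi.integrable_comp_of_integrable hp.1
  have e1 : ∫ ω, g (fun k => X (j k) ω) ^ 2 ∂P = ∫ y, g y ^ 2 ∂(Measure.pi fun _ : Fin m => F) := by
    rw [← hmp.map_eq, integral_map hmp.measurable.aemeasurable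
      (hg.pow_const 2).aestronglyMeasurable]
  have e2 : ∫ ω, proj F g (X i ω) ^ 2 ∂P = ∫ x, proj F g x ^ 2 ∂F := by
    rw [← hXi.map_eq, integral_map hXi.measurable.aemeasurable, hXi.map_eq]
    rw [hXi.map_eq]
    exact ((measurable_proj F hg).pow_const 2).aestronglyMeasurable
  calc ∫ ω, (g (fun k => X (j k) ω) - proj F g (X i ω)) ^ 2 ∂P
      ≤ ∫ ω, (2 * g (fun k => X (j k) ω) ^ 2 + 2 * proj F g (X i ω) ^ 2) ∂P := by
        refine integral_mono_of_nonneg (ae_of_all _ fun ω => sq_nonneg _)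
          ((i1.const_mul 2).add (i2.const_mul 2)) (ae_of_all _ fun ω => ?_)
        simp only
        nlinarith [sq_nonneg (g (fun k => X (j k) ω) + proj F g (X i ω))]
    _ = 2 * ∫ y, g y ^ 2 ∂(Measure.pi fun _ : Fin m => F) + 2 * ∫ x, proj F g x ^ 2 ∂F := by
        rw [integral_add (i1.const_mul 2) (i2.const_mul 2), integral_const_mul, integral_const_mul,
          e1, e2]
    _ ≤ 4 * ∫ y, g y ^ 2 ∂(Measure.pi fun _ : Fin m => F) := by linarith [hp.2]

include hsymm in
/-- Second moment of the deviation of an average through `i` from its conditional mean. -/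
lemma integral_throughAvg_sub_proj_sq_le (hg : Measurable g) {C : ℝ} (hC : ∀ y, |g y| ≤ C)
    {n i : ℕ} (hmn : m < n) (hi : i < n) :
    ∫ ω, (throughAvg g n i (fun l => X l ω) - proj F g (X i ω)) ^ 2 ∂P
      ≤ 4 * ((m : ℝ) - 1) ^ 2 / ((n : ℝ) - 1)
        * ∫ y, g y ^ 2 ∂(Measure.pi fun _ : Fin m => F) := by
  have hm : 1 ≤ m := Nat.one_le_iff_ne_zero.2 (NeZero.ne m)
  have hn1 : (0 : ℝ) < (n : ℝ) - 1 := by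
    have : (1 : ℝ) < n := by exact_mod_cast (by omega : 1 < n)
    linarith
  set J := tuplesThrough m n i with hJ
  set N : ℝ := (((n - 1).choose (m - 1) : ℕ) : ℝ) with hN
  have hNpos : 0 < N := by
    rw [hN]; exact_mod_cast Nat.choose_pos (by omega)
  have hJcard : (J.card : ℝ) = N := by rw [hJ, card_tuplesThrough hm hi]
  set M := ∫ y, g y ^ 2 ∂(Measure.pi fun _ : Fin m => F) with hM
  have hM0 : 0 ≤ M := integral_nonneg fun y => sq_nonneg _
  set D : (Fin m → ℕ) → Ω → ℝ := fun j ω => g (fun k => X (j k) ω) - proj F g (X i ω) with hD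
  have hprojC : ∀ x, |proj F g x| ≤ C := fun x => by
    have := norm_integral_le_of_norm_le_const (μ := Measure.pi fun _ : Fin m => F)
      (f := fun y => g (Function.update y 0 x)) (C := C) (ae_of_all _ fun y => hC _)
    simpa [proj] using this
  have hDm : ∀ j, Measurable (D j) := fun j =>
    (hg.comp (measurable_pi_lambda _ fun k => hX _)).sub ((measurable_proj F hg).comp (hX i))
  have hDb : ∀ j ω, |D j ω| ≤ C + C := fun j ω =>
    (abs_sub _ _).trans (add_le_add (hC _) (hprojC _))
  have hDD : ∀ j j', Integrable (fun ω => D j ω * D j' ω) P := fun j j' => by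
    refine Integrable.of_bound (C := (C + C) * (C + C)) ((hDm j).mul (hDm j')).aestronglyMeasurable
      (ae_of_all _ fun ω => ?_)
    rw [Real.norm_eq_abs, abs_mul]
    exact mul_le_mul (hDb _ _) (hDb _ _) (abs_nonneg _) ((abs_nonneg _).trans (hDb j ω))
  have hrew : ∀ ω, (throughAvg g n i (fun l => X l ω) - proj F g (X i ω)) ^ 2
      = (N⁻¹) ^ 2 * ∑ j ∈ J, ∑ j' ∈ J, D j ω * D j' ω := by
    intro ω
    have : throughAvg g n i (fun l => X l ω) - proj F g (X i ω) = N⁻¹ * ∑ j ∈ J, D j ω := by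
      simp only [hD]
      rw [Finset.sum_sub_distrib, Finset.sum_const, nsmul_eq_mul, hJcard, mul_sub,
        inv_mul_cancel_left₀ hNpos.ne']
      rfl
    rw [this, mul_pow, sq (∑ j ∈ J, D j ω), Finset.sum_mul_sum]
  have hself : ∀ j ∈ J, ∫ ω, D j ω * D j ω ∂P ≤ 4 * M := fun j hj => by
    have h1 := integral_sub_proj_sq_le hX hindep hlaw hg hC
      (mem_tuplesThrough.1 hj).1.2.injective i
    simp only [hD, ← sq]
    exact h1
  -- The covariance vanishes unless j and j' share an entry other than i, and is then at most 4M by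
  -- ab ≤ (a² + b²)/2. The sum over k is a union bound over the shared entry.
  have hcov : ∀ j ∈ J, ∀ j' ∈ J, ∫ ω, D j ω * D j' ω ∂P
      ≤ ∑ k with j k ≠ i, if ∃ k', j' k' = j k then 4 * M else 0 := by
    intro j hj j' hj'
    by_cases hd : ∀ k, j k ≠ i → ∀ k', j' k' ≠ j k
    · rw [hD, integral_sub_proj_mul_sub_proj_eq_zero hX hindep hlaw hsymm hg hC
        (mem_tuplesThrough.1 hj).1.2.injective (mem_tuplesThrough.1 hj).2
        (mem_tuplesThrough.1 hj').2 hd]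
      exact Finset.sum_nonneg fun k _ => by split_ifs <;> positivity
    · push Not at hd
      obtain ⟨k, hk, hk'⟩ := hd
      calc ∫ ω, D j ω * D j' ω ∂P ≤ ∫ ω, (1 / 2 * (D j ω * D j ω) + 1 / 2 * (D j' ω * D j' ω)) ∂P := by
            refine integral_mono (hDD j j')
              (((hDD j j).const_mul _).add ((hDD j' j').const_mul _)) fun ω => ?_
            simp only
            nlinarith [sq_nonneg (D j ω - D j' ω)]
        _ = 1 / 2 * ∫ ω, D j ω * D j ω ∂P + 1 / 2 * ∫ ω, D j' ω * D j' ω ∂P := by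
            rw [integral_add ((hDD j j).const_mul _) ((hDD j' j').const_mul _),
              integral_const_mul, integral_const_mul]
        _ ≤ 4 * M := by linarith [hself j hj, hself j' hj']
        _ = if ∃ k', j' k' = j k then 4 * M else 0 := by rw [if_pos hk']
        _ ≤ _ := Finset.single_le_sum
            (f := fun k => if ∃ k', j' k' = j k then 4 * M else 0)
            (fun k _ => by split_ifs <;> positivity)
            (Finset.mem_filter.2 ⟨Finset.mem_univ k, hk⟩)
  have hrow : ∀ j ∈ J, ∑ j' ∈ J, ∫ ω, D j ω * D j' ω ∂P
      ≤ N * ((m : ℝ) - 1) ^ 2 / ((n : ℝ) - 1) * (4 * M) := by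
    intro j hj
    obtain ⟨⟨hjn, hjm⟩, k₀, hk₀⟩ := mem_tuplesThrough.1 hj
    calc ∑ j' ∈ J, ∫ ω, D j ω * D j' ω ∂P
        ≤ ∑ j' ∈ J, ∑ k with j k ≠ i, if ∃ k', j' k' = j k then 4 * M else 0 :=
          Finset.sum_le_sum fun j' hj' => hcov j hj j' hj'
      _ = ∑ k with j k ≠ i, ((J.filter fun j' => ∃ k', j' k' = j k).card : ℝ) * (4 * M) := by
          rw [Finset.sum_comm]
          refine Finset.sum_congr rfl fun k _ => ?_
          rw [← Finset.sum_filter, Finset.sum_const, nsmul_eq_mul]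
      -- A given index other than i occurs in a proportion (m-1)/(n-1) of the tuples through i; the
      -- remaining sum runs over the m-1 other entries of j.
      _ = ∑ k with j k ≠ i, N * ((m : ℝ) - 1) / ((n : ℝ) - 1) * (4 * M) := by
          refine Finset.sum_congr rfl fun k hk => ?_
          have h1 := card_tuplesThrough_filter_mul hm hmn.le hi (hjn k)
            (Ne.symm (Finset.mem_filter.1 hk).2)
          congr 1
          rw [eq_div_iff hn1.ne']
          have h2 : ((n - 1 : ℕ) : ℝ) = (n : ℝ) - 1 := by
            rw [Nat.cast_sub (by omega)]; simp
          have h3 : ((m - 1 : ℕ) : ℝ) = (m : ℝ) - 1 := by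
            rw [Nat.cast_sub hm]; simp
          rw [← h2, ← h3, hN]
          exact_mod_cast h1
      _ = N * ((m : ℝ) - 1) ^ 2 / ((n : ℝ) - 1) * (4 * M) := by
          rw [Finset.sum_const, nsmul_eq_mul]
          have : (Finset.univ.filter fun k => j k ≠ i) = Finset.univ.erase k₀ := by
            ext k
            simp only [Finset.mem_filter, Finset.mem_univ, true_and, Finset.mem_erase, and_true]
            rw [← hk₀]
            exact hjm.injective.ne_iff
          rw [this, Finset.card_erase_of_mem (Finset.mem_univ _), Finset.card_univ,
            Fintype.card_fin, Nat.cast_sub hm]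
          push_cast
          ring
  simp only [hrew]
  rw [integral_const_mul, integral_finsetSum _ fun j _ => integrable_finsetSum _ fun j' _ => hDD j j']
  simp only [fun j => integral_finsetSum (μ := P) J fun j' (_ : j' ∈ J) => hDD j j']
  calc (N⁻¹) ^ 2 * ∑ j ∈ J, ∑ j' ∈ J, ∫ ω, D j ω * D j' ω ∂P
      ≤ (N⁻¹) ^ 2 * ∑ j ∈ J, N * ((m : ℝ) - 1) ^ 2 / ((n : ℝ) - 1) * (4 * M) := by
        gcongr with j hj
        exact hrow j hj
    _ = 4 * ((m : ℝ) - 1) ^ 2 / ((n : ℝ) - 1) * M := by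
        rw [Finset.sum_const, nsmul_eq_mul, hJcard]
        field_simp

/-- For the tail of the kernel, which need not be square integrable; no cancellation is used, only
the triangle inequality and the L¹ contraction. -/
lemma integral_abs_throughAvg_sub_proj_le (hg : Measurable g)
    (hint : Integrable g (Measure.pi fun _ : Fin m => F)) {n i : ℕ} (hmn : m < n) (hi : i < n) :
    Integrable (fun ω => |throughAvg g n i (fun l => X l ω) - proj F g (X i ω)|) P ∧
    ∫ ω, |throughAvg g n i (fun l => X l ω) - proj F g (X i ω)| ∂P
      ≤ 2 * ∫ y, |g y| ∂(Measure.pi fun _ : Fin m => F) := by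
  have hm : 1 ≤ m := Nat.one_le_iff_ne_zero.2 (NeZero.ne m)
  set J := tuplesThrough m n i with hJ
  set N : ℝ := (((n - 1).choose (m - 1) : ℕ) : ℝ) with hN
  have hNpos : 0 < N := by
    rw [hN]; exact_mod_cast Nat.choose_pos (by omega)
  have hJcard : (J.card : ℝ) = N := by rw [hJ, card_tuplesThrough hm hi]
  have hp := integrable_proj_and_integral_abs_le F hg hint
  have hXi : MeasurePreserving (X i) P F := ⟨hX i, hlaw i⟩
  have hmp : ∀ j ∈ J, MeasurePreserving (fun ω k => X (j k) ω) P (Measure.pi fun _ : Fin m => F) :=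
    fun j hj => measurePreserving_tuple hX hindep hlaw (mem_tuplesThrough.1 hj).1.2.injective
  have i1 : ∀ j ∈ J, Integrable (fun ω => g (fun k => X (j k) ω)) P := fun j hj =>
    (hmp j hj).integrable_comp_of_integrable hint
  have i2 : Integrable (fun ω => proj F g (X i ω)) P := hXi.integrable_comp_of_integrable hp.1
  have i3 : Integrable (fun ω => throughAvg g n i (fun l => X l ω)) P :=
    (integrable_finsetSum _ i1).const_mul _
  refine ⟨(i3.sub i2).abs, ?_⟩
  have e1 : ∀ j ∈ J, ∫ ω, |g (fun k => X (j k) ω)| ∂P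
      = ∫ y, |g y| ∂(Measure.pi fun _ : Fin m => F) := fun j hj => by
    rw [← (hmp j hj).map_eq, integral_map (hmp j hj).measurable.aemeasurable
      hg.abs.aestronglyMeasurable]
  have e2 : ∫ ω, |proj F g (X i ω)| ∂P = ∫ x, |proj F g x| ∂F := by
    have := integral_map (μ := P) (φ := X i) (hX i).aemeasurable
      (f := fun x => |proj F g x|) (measurable_proj F hg).abs.aestronglyMeasurable
    rw [hlaw i] at this
    exact this.symm
  have e3 : ∫ ω, |throughAvg g n i (fun l => X l ω)| ∂P
      ≤ ∫ y, |g y| ∂(Measure.pi fun _ : Fin m => F) := by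
    calc ∫ ω, |throughAvg g n i (fun l => X l ω)| ∂P
        ≤ ∫ ω, N⁻¹ * ∑ j ∈ J, |g (fun k => X (j k) ω)| ∂P := by
          refine integral_mono i3.abs
            ((integrable_finsetSum _ fun j hj => (i1 j hj).abs).const_mul _) fun ω => ?_
          simp only [throughAvg]
          rw [abs_mul, abs_of_pos (inv_pos.2 hNpos)]
          gcongr
          exact Finset.abs_sum_le_sum_abs _ _
      _ = ∫ y, |g y| ∂(Measure.pi fun _ : Fin m => F) := by
          rw [integral_const_mul, integral_finsetSum _ fun j hj => (i1 j hj).abs,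
            Finset.sum_congr rfl e1, Finset.sum_const, nsmul_eq_mul, hJcard,
            inv_mul_cancel_left₀ hNpos.ne']
  calc ∫ ω, |throughAvg g n i (fun l => X l ω) - proj F g (X i ω)| ∂P
      ≤ ∫ ω, (|throughAvg g n i (fun l => X l ω)| + |proj F g (X i ω)|) ∂P :=
        integral_mono (i3.sub i2).abs (i3.abs.add i2.abs) fun ω => abs_sub _ _
    _ = ∫ ω, |throughAvg g n i (fun l => X l ω)| ∂P + ∫ ω, |proj F g (X i ω)| ∂P :=
        integral_add i3.abs i2.abs
    _ ≤ 2 * ∫ y, |g y| ∂(Measure.pi fun _ : Fin m => F) := by rw [e2]; linarith [hp.2]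

end Sample

/-! ### Truncation: the remainder is negligible in mean square. -/

lemma sq_le_rpow_mul_rpow_of_le {a t : ℝ} (ha : 0 ≤ a) (h : a ≤ t) :
    a ^ 2 ≤ t ^ (1 / 3 : ℝ) * a ^ (5 / 3 : ℝ) := by
  have : a ^ 2 = a ^ (1 / 3 : ℝ) * a ^ (5 / 3 : ℝ) := by
    rw [← Real.rpow_add_of_nonneg ha (by norm_num) (by norm_num), ← Real.rpow_natCast]
    norm_num
  rw [this]
  gcongr

lemma le_rpow_mul_rpow_of_le {a t : ℝ} (ht : 0 < t) (h : t ≤ a) :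
    a ≤ t ^ (-(2 / 3) : ℝ) * a ^ (5 / 3 : ℝ) := by
  have ha : 0 < a := ht.trans_le h
  have e : a ^ (5 / 3 : ℝ) = a ^ (2 / 3 : ℝ) * a := by
    conv_rhs => rw [← Real.rpow_one a, ← Real.rpow_mul ha.le, ← Real.rpow_add ha]
    norm_num
  rw [e, Real.rpow_neg ht.le, ← mul_assoc]
  refine le_mul_of_one_le_left ha.le ?_
  rw [inv_mul_eq_div, one_le_div (by positivity)]
  gcongr

section Remainder

variable {Ω : Type*} [MeasurableSpace Ω] {P : Measure Ω} [IsProbabilityMeasure P]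
  {F : Measure ℝ} [IsProbabilityMeasure F] {X : ℕ → Ω → ℝ} (hX : ∀ i, Measurable (X i))
  (hindep : iIndepFun X P) (hlaw : ∀ i, P.map (X i) = F) {m : ℕ} [NeZero m]
  {h : (Fin m → ℝ) → ℝ} (hmeas : Measurable h)
  (hsymm : ∀ (σ : Equiv.Perm (Fin m)) (y : Fin m → ℝ), h (fun k => y (σ k)) = h y)
  (hint : Integrable (fun y => |h y| ^ (5 / 3 : ℝ)) (Measure.pi fun _ : Fin m => F))

include hX hindep hlaw hmeas hsymm hint

/-- The mean square distance between the averages through `i` and their conditional means given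
the `i`-th observation tends to zero. -/
lemma tendstoInMeasure_sum_throughAvg_sub_proj_sq :
    TendstoInMeasure P (fun (n : ℕ) ω => (∑ i ∈ Finset.range n,
      (throughAvg h n i (fun l => X l ω) - proj F h (X i ω)) ^ 2) / n) atTop (fun _ => 0) := by
  set π := Measure.pi fun _ : Fin m => F with hπ
  set M := ∫ y, |h y| ^ (5 / 3 : ℝ) ∂π with hM
  have hM0 : 0 ≤ M := integral_nonneg fun y => by positivity
  -- Truncation at level n, applied to h itself so that symmetry survives. The 5/3 moment yields E
  -- S² ≤ n^(1/3) M and E |L| ≤ n^(-2/3) M.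
  let S : ℕ → (Fin m → ℝ) → ℝ := fun n y => if |h y| ≤ n then h y else 0
  let L : ℕ → (Fin m → ℝ) → ℝ := fun n y => if |h y| ≤ n then 0 else h y
  have hset : ∀ n : ℕ, MeasurableSet {y | |h y| ≤ n} := fun n =>
    measurableSet_le hmeas.abs measurable_const
  have hSm : ∀ n, Measurable (S n) := fun n => Measurable.ite (hset n) hmeas measurable_const
  have hLm : ∀ n, Measurable (L n) := fun n => Measurable.ite (hset n) measurable_const hmeas
  have hSL : ∀ n, h = fun y => S n y + L n y := fun n => by
    ext y; simp only [S, L]; split_ifs <;> simp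
  have hSsymm : ∀ n (σ : Equiv.Perm (Fin m)) (y : Fin m → ℝ),
      S n (fun k => y (σ k)) = S n y := fun n σ y => by simp only [S, hsymm]
  have hSb : ∀ n y, |S n y| ≤ n := fun n y => by
    simp only [S]; split_ifs with hy
    · exact hy
    · simp
  have hSsq : ∀ n : ℕ, ∫ y, S n y ^ 2 ∂π ≤ (n : ℝ) ^ (1 / 3 : ℝ) * M := fun n => by
    rw [hM, ← integral_const_mul]
    refine integral_mono_of_nonneg (ae_of_all _ fun y => sq_nonneg _) (hint.const_mul _)
      (ae_of_all _ fun y => ?_)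
    simp only [S]; split_ifs with hy
    · rw [← sq_abs]; exact sq_le_rpow_mul_rpow_of_le (abs_nonneg _) hy
    · simp only [ne_eq, OfNat.ofNat_ne_zero, not_false_eq_true, zero_pow]; positivity
  have hLle : ∀ n : ℕ, 1 ≤ n → ∀ y, |L n y| ≤ (n : ℝ) ^ (-(2 / 3) : ℝ) * |h y| ^ (5 / 3 : ℝ) :=
    fun n hn y => by
      simp only [L]; split_ifs with hy
      · simp only [abs_zero]; positivity
      · exact le_rpow_mul_rpow_of_le (by exact_mod_cast hn) (not_le.1 hy).le
  have hLi : ∀ n : ℕ, 1 ≤ n → Integrable (L n) π := fun n hn =>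
    (hint.const_mul _).mono' (hLm n).aestronglyMeasurable (ae_of_all _ (hLle n hn))
  have hLabs : ∀ n : ℕ, 1 ≤ n → ∫ y, |L n y| ∂π ≤ (n : ℝ) ^ (-(2 / 3) : ℝ) * M := fun n hn => by
    rw [hM, ← integral_const_mul]
    exact integral_mono (hLi n hn).abs (hint.const_mul _) (hLle n hn)
  let a : ℕ → ℕ → Ω → ℝ := fun n i ω => throughAvg (S n) n i (fun l => X l ω) - proj F (S n) (X i ω)
  let b : ℕ → ℕ → Ω → ℝ := fun n i ω => throughAvg (L n) n i (fun l => X l ω) - proj F (L n) (X i ω)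
  have ham : ∀ n i, Measurable (a n i) := fun n i =>
    ((Finset.measurable_fun_sum _ fun j _ => (hSm n).comp
      (measurable_pi_lambda _ fun k => hX _)).const_mul _).sub ((measurable_proj F (hSm n)).comp (hX i))
  have hprojb : ∀ n x, |proj F (S n) x| ≤ n := fun n x => by
    have := norm_integral_le_of_norm_le_const (μ := Measure.pi fun _ : Fin m => F)
      (f := fun y => S n (Function.update y 0 x)) (C := n) (ae_of_all _ fun y => hSb n _)
    simpa [proj] using this
  have hai : ∀ n i, Integrable (fun ω => a n i ω ^ 2) P := fun n i => by
    have hab : ∀ ω, |a n i ω| ≤ (((n - 1).choose (m - 1) : ℕ) : ℝ)⁻¹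
        * ((tuplesThrough m n i).card * n) + n := fun ω => by
      refine (abs_sub _ _).trans (add_le_add ?_ (hprojb n _))
      rw [throughAvg, abs_mul, abs_of_nonneg (by positivity)]
      gcongr
      refine (Finset.abs_sum_le_sum_abs _ _).trans ?_
      rw [← nsmul_eq_mul, ← Finset.sum_const]
      exact Finset.sum_le_sum fun j _ => hSb n _
    refine Integrable.of_bound ((ham n i).pow_const 2).aestronglyMeasurable
      (ae_of_all _ fun ω => ?_) (C := ((((n - 1).choose (m - 1) : ℕ) : ℝ)⁻¹
        * ((tuplesThrough m n i).card * n) + n) ^ 2)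
    rw [Real.norm_eq_abs, abs_pow]
    exact pow_le_pow_left₀ (abs_nonneg _) (hab ω) 2
  have hpow : ∀ p : ℝ, 0 < p → Tendsto (fun n : ℕ => (n : ℝ) ^ (-p)) atTop (𝓝 0) := fun p hp =>
    (tendsto_rpow_neg_atTop hp).comp tendsto_natCast_atTop_atTop
  -- Each E a² is O(n^(1/3) / (n-1)), so the mean is O(n^(-2/3)); the constant 8 absorbs n/(n-1) ≤
  -- 2.
  have hA : TendstoInMeasure P (fun (n : ℕ) ω => (∑ i ∈ Finset.range n, a n i ω ^ 2) / n) atTop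
      (fun _ => 0) := by
    refine tendstoInMeasure_zero_of_integral (fun n ω => by positivity)
      (Eventually.of_forall fun n => (integrable_finsetSum _ fun i _ => hai n i).div_const _) ?_
    refine squeeze_zero' (Eventually.of_forall fun n => integral_nonneg fun ω => by positivity)
      (g := fun n : ℕ => 8 * ((m : ℝ) - 1) ^ 2 * M * (n : ℝ) ^ (-(2 / 3) : ℝ)) ?_
      (by simpa using (hpow (2 / 3) (by norm_num)).const_mul (8 * ((m : ℝ) - 1) ^ 2 * M))
    filter_upwards [eventually_gt_atTop m] with n hn
    have hm : 1 ≤ m := Nat.one_le_iff_ne_zero.2 (NeZero.ne m)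
    have hn2 : (2 : ℝ) ≤ n := by exact_mod_cast (by omega : 2 ≤ n)
    have hn0 : (0 : ℝ) < n := by linarith
    rw [integral_div, integral_finsetSum _ fun i _ => hai n i, div_le_iff₀ hn0]
    calc ∑ i ∈ Finset.range n, ∫ ω, a n i ω ^ 2 ∂P
        ≤ ∑ i ∈ Finset.range n, 4 * ((m : ℝ) - 1) ^ 2 / ((n : ℝ) - 1)
            * ((n : ℝ) ^ (1 / 3 : ℝ) * M) := by
          refine Finset.sum_le_sum fun i hi => ?_
          refine (integral_throughAvg_sub_proj_sq_le hX hindep hlaw (hSsymm n) (hSm n) (hSb n) hn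
            (Finset.mem_range.1 hi)).trans ?_
          refine mul_le_mul_of_nonneg_left (hSsq n) (div_nonneg (by positivity) (by linarith))
      _ = 4 * ((m : ℝ) - 1) ^ 2 * M * (n : ℝ) ^ (1 / 3 : ℝ) * (n / ((n : ℝ) - 1)) := by
          rw [Finset.sum_const, Finset.card_range, nsmul_eq_mul]; ring
      _ ≤ 4 * ((m : ℝ) - 1) ^ 2 * M * (n : ℝ) ^ (1 / 3 : ℝ) * 2 := by
          gcongr
          rw [div_le_iff₀ (by linarith)]; linarith
      _ = 8 * ((m : ℝ) - 1) ^ 2 * M * (n : ℝ) ^ (-(2 / 3) : ℝ) * n := by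
          have : (n : ℝ) ^ (1 / 3 : ℝ) = (n : ℝ) ^ (-(2 / 3) : ℝ) * n := by
            conv_rhs => rw [← Real.rpow_add_one hn0.ne']
            norm_num
          rw [this]; ring
  have hbi : ∀ᶠ n in atTop, Integrable (fun ω => (∑ i ∈ Finset.range n, |b n i ω|) / Real.sqrt n) P := by
    filter_upwards [eventually_gt_atTop m] with n hn
    exact (integrable_finsetSum _ fun i hi => (integral_abs_throughAvg_sub_proj_le hX hindep hlaw
      (hLm n) (hLi n (by omega)) hn (Finset.mem_range.1 hi)).1).div_const _
  -- The n terms add up to O(n · n^(-2/3)); dividing by √n leaves n^(-1/6). Squared, this controls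
  -- n⁻¹ ∑ b², because ∑ b² ≤ (∑ |b|)².
  have hB : TendstoInMeasure P (fun (n : ℕ) ω => (∑ i ∈ Finset.range n, |b n i ω|) / Real.sqrt n)
      atTop (fun _ => 0) := by
    refine tendstoInMeasure_zero_of_integral (fun n ω => by positivity) hbi ?_
    refine squeeze_zero' (Eventually.of_forall fun n => integral_nonneg fun ω => by positivity)
      (g := fun n : ℕ => 2 * M * (n : ℝ) ^ (-(1 / 6) : ℝ)) ?_
      (by simpa using (hpow (1 / 6) (by norm_num)).const_mul (2 * M))
    filter_upwards [eventually_gt_atTop m] with n hn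
    have hn0 : (0 : ℝ) < n := by exact_mod_cast (by omega : 0 < n)
    have key := fun i (hi : i ∈ Finset.range n) => integral_abs_throughAvg_sub_proj_le hX hindep
      hlaw (hLm n) (hLi n (by omega)) hn (Finset.mem_range.1 hi)
    rw [integral_div, integral_finsetSum _ fun i hi => (key i hi).1,
      div_le_iff₀ (Real.sqrt_pos.2 hn0)]
    calc ∑ i ∈ Finset.range n, ∫ ω, |b n i ω| ∂P
        ≤ ∑ i ∈ Finset.range n, 2 * ((n : ℝ) ^ (-(2 / 3) : ℝ) * M) :=
          Finset.sum_le_sum fun i hi => (key i hi).2.trans (by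
            have := hLabs n (by omega)
            linarith)
      _ = 2 * M * ((n : ℝ) ^ (-(2 / 3) : ℝ) * n) := by
          rw [Finset.sum_const, Finset.card_range, nsmul_eq_mul]; ring
      _ = 2 * M * (n : ℝ) ^ (-(1 / 6) : ℝ) * Real.sqrt n := by
          have : (n : ℝ) ^ (-(2 / 3) : ℝ) * n = (n : ℝ) ^ (-(1 / 6) : ℝ) * Real.sqrt n := by
            rw [Real.sqrt_eq_rpow, ← Real.rpow_add hn0, ← Real.rpow_add_one hn0.ne']
            norm_num
          rw [this]; ring
  have hAB := tendstoInMeasure_comp₂ hA hB (fun u v => 2 * u + 2 * v ^ 2) (by fun_prop)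
  simp only [ne_eq, OfNat.ofNat_ne_zero, not_false_eq_true, zero_pow, mul_zero, add_zero] at hAB
  refine tendstoInMeasure_zero_of_abs_le hAB ?_
  filter_upwards [eventually_gt_atTop m] with n hn
  have hn0 : (0 : ℝ) < n := by exact_mod_cast (by omega : 0 < n)
  have hSi : Integrable (S n) π :=
    Integrable.of_bound (C := n) (hSm n).aestronglyMeasurable (ae_of_all _ (hSb n))
  -- The projection is additive only where the sections are integrable, hence the passage to almost
  -- every x.
  have hae : ∀ᵐ x ∂F, proj F h x = proj F (S n) x + proj F (L n) x := by
    filter_upwards [ae_integrable_update F hSi, ae_integrable_update F (hLi n (by omega))] with x h1 h2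
    rw [proj, proj, proj, ← integral_add h1 h2]
    conv_lhs => rw [hSL n]
  have hae' : ∀ᵐ ω ∂P, ∀ i, proj F h (X i ω) = proj F (S n) (X i ω) + proj F (L n) (X i ω) := by
    rw [ae_all_iff]
    intro i
    exact ae_of_ae_map (hX i).aemeasurable (by rw [hlaw i]; exact hae)
  filter_upwards [hae'] with ω hω
  have hdec : ∀ i, throughAvg h n i (fun l => X l ω) - proj F h (X i ω) = a n i ω + b n i ω := by
    intro i
    have : throughAvg h n i (fun l => X l ω) = throughAvg (S n) n i (fun l => X l ω)
        + throughAvg (L n) n i (fun l => X l ω) := by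
      rw [← throughAvg_add, ← hSL n]
    rw [this, hω i]
    simp only [a, b]
    ring
  rw [abs_of_nonneg (by positivity), div_pow, Real.sq_sqrt hn0.le, ← mul_div_assoc, ← mul_div_assoc,
    ← add_div]
  gcongr
  simp only [hdec]
  have h1 : ∑ i ∈ Finset.range n, b n i ω ^ 2 ≤ (∑ i ∈ Finset.range n, |b n i ω|) ^ 2 := by
    have := Finset.sum_sq_le_sq_sum_of_nonneg (s := Finset.range n) (f := fun i => |b n i ω|)
      (fun i _ => abs_nonneg _)
    simpa only [sq_abs] using this
  calc ∑ i ∈ Finset.range n, (a n i ω + b n i ω) ^ 2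
      ≤ ∑ i ∈ Finset.range n, (2 * a n i ω ^ 2 + 2 * b n i ω ^ 2) :=
        Finset.sum_le_sum fun i _ => by nlinarith [sq_nonneg (a n i ω - b n i ω)]
    _ = 2 * ∑ i ∈ Finset.range n, a n i ω ^ 2 + 2 * ∑ i ∈ Finset.range n, b n i ω ^ 2 := by
        rw [Finset.sum_add_distrib, Finset.mul_sum, Finset.mul_sum]
    _ ≤ _ := by linarith

end Remainder

/-! ### Assembling the weak law for the jackknife variance. -/

lemma abs_sum_mul_div_le {ι : Type*} (s : Finset ι) (y r : ι → ℝ) {d : ℝ} (hd : 0 ≤ d) :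
    |(∑ i ∈ s, y i * r i) / d|
      ≤ Real.sqrt ((∑ i ∈ s, y i ^ 2) / d) * Real.sqrt ((∑ i ∈ s, r i ^ 2) / d) := by
  rw [← Real.sqrt_mul (by positivity)]
  refine Real.abs_le_sqrt ?_
  rw [div_pow, div_mul_div_comm, ← sq]
  gcongr
  exact Finset.sum_mul_sq_le_sq_mul_sq s y r

lemma sq_add_div_le (n : ℕ) (u : ℝ) (r : ℕ → ℝ) :
    ((u + ∑ i ∈ Finset.range n, r i) / n) ^ 2
      ≤ 2 * (u / n) ^ 2 + 2 * ((∑ i ∈ Finset.range n, r i ^ 2) / n) := by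
  rcases Nat.eq_zero_or_pos n with rfl | hn
  · simp
  have hn0 : (0 : ℝ) < n := by exact_mod_cast hn
  have h1 : (∑ i ∈ Finset.range n, r i) ^ 2 ≤ n * ∑ i ∈ Finset.range n, r i ^ 2 := by
    simpa using sq_sum_le_card_mul_sum_sq (s := Finset.range n) (f := r)
  have h2 : ((∑ i ∈ Finset.range n, r i) / n) ^ 2 ≤ (∑ i ∈ Finset.range n, r i ^ 2) / n := by
    rw [div_pow, div_le_div_iff₀ (by positivity) hn0]
    nlinarith
  rw [add_div]
  nlinarith [sq_nonneg (u / n - (∑ i ∈ Finset.range n, r i) / n)]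

/-- The extra n in the numerator comes from normalizing the sums of squares by n ℓ² instead of ℓ².
-/
lemma tendsto_jackknife_factor (m : ℕ) :
    Tendsto (fun n : ℕ => ((n : ℝ) - 1) * n / ((n : ℝ) - m) ^ 2) atTop (𝓝 1) := by
  have h1 : Tendsto (fun n : ℕ => (1 - 1 * (n : ℝ)⁻¹) / (1 - m * (n : ℝ)⁻¹) ^ 2) atTop (𝓝 1) := by
    have h0 := tendsto_inv_atTop_nhds_zero_nat (𝕜 := ℝ)
    have := (tendsto_const_nhds (x := (1 : ℝ))).sub (h0.const_mul 1) |>.div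
      (((tendsto_const_nhds (x := (1 : ℝ))).sub (h0.const_mul (m : ℝ))).pow 2) (by simp)
    simpa [Pi.div_def] using this
  refine h1.congr' ?_
  filter_upwards [eventually_gt_atTop m] with n hn
  have hn0 : (0 : ℝ) < n := by exact_mod_cast (by omega : 0 < n)
  have hnm : (n : ℝ) - m ≠ 0 := by
    have : (m : ℝ) < n := by exact_mod_cast hn
    linarith
  have e : 1 - (m : ℝ) * (n : ℝ)⁻¹ = (n - m) / n := by field_simp
  rw [e]
  field_simp

section Main

variable {Ω : Type*} [MeasurableSpace Ω] {P : Measure Ω} [IsProbabilityMeasure P]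
  {F : Measure ℝ} [IsProbabilityMeasure F] {X : ℕ → Ω → ℝ} (hX : ∀ i, Measurable (X i))
  (hindep : iIndepFun X P) (hlaw : ∀ i, P.map (X i) = F) {m : ℕ} [NeZero m]
  {h : (Fin m → ℝ) → ℝ} (hmeas : Measurable h)

lemma hTilde_eq_proj_sub (F : Measure ℝ) (h : (Fin m → ℝ) → ℝ) (x : ℝ) :
    hTilde F h x = proj F h x - theta F h := rfl

include hmeas in
lemma measurable_hTilde : Measurable (hTilde F h) :=
  (measurable_proj F hmeas).sub measurable_const

include hmeas in
lemma integrable_hTilde (hint : Integrable h (Measure.pi fun _ : Fin m => F)) :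
    Integrable (hTilde F h) F :=
  (integrable_proj_and_integral_abs_le F hmeas hint).1.sub (integrable_const _)

include hmeas in
lemma integral_hTilde (hint : Integrable h (Measure.pi fun _ : Fin m => F)) :
    ∫ x, hTilde F h x ∂F = 0 := by
  have h1 := integral_sub (integrable_proj_and_integral_abs_le F hmeas hint).1
    (integrable_const (theta F h))
  simp only [hTilde_eq_proj_sub, h1]
  have h2 : ∫ x, proj F h x ∂F = theta F h := integral_integral_update F hint
  rw [h2]
  simp

include hmeas in
lemma integrable_abs_hTilde_rpow
    (hint : Integrable (fun y => |h y| ^ (5 / 3 : ℝ)) (Measure.pi fun _ : Fin m => F)) :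
    Integrable (fun x => |hTilde F h x| ^ (5 / 3 : ℝ)) F := by
  have h1 := (integrable_proj_rpow_and_integral_le F (by norm_num) hmeas hint).1
  refine ((h1.add (integrable_const (|theta F h| ^ (5 / 3 : ℝ)))).const_mul
    (2 ^ (5 / 3 : ℝ))).mono'
    ((measurable_hTilde hmeas).abs.pow_const _).aestronglyMeasurable (ae_of_all _ fun x => ?_)
  rw [Real.norm_eq_abs, abs_of_nonneg (by positivity), Pi.add_apply, hTilde_eq_proj_sub]
  have h2 : |proj F h x - theta F h| ≤ 2 * max |proj F h x| |theta F h| := by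
    refine (abs_sub _ _).trans ?_
    linarith [le_max_left |proj F h x| |theta F h|, le_max_right |proj F h x| |theta F h|]
  calc |proj F h x - theta F h| ^ (5 / 3 : ℝ)
      ≤ (2 * max |proj F h x| |theta F h|) ^ (5 / 3 : ℝ) := by gcongr
    _ = 2 ^ (5 / 3 : ℝ) * max |proj F h x| |theta F h| ^ (5 / 3 : ℝ) :=
        Real.mul_rpow (by norm_num) (by positivity)
    _ ≤ 2 ^ (5 / 3 : ℝ) * (|proj F h x| ^ (5 / 3 : ℝ) + |theta F h| ^ (5 / 3 : ℝ)) := by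
        gcongr
        rcases max_cases |proj F h x| |theta F h| with hc | hc <;> rw [hc.1]
        · exact le_add_of_nonneg_right (by positivity)
        · exact le_add_of_nonneg_left (by positivity)

include hX hindep hlaw hmeas

/-- The weak law for the jackknife variance with general norming constants. -/
lemma tendstoInMeasure_jackVar_div
    (hsymm : ∀ (σ : Equiv.Perm (Fin m)) (y : Fin m → ℝ), h (fun k => y (σ k)) = h y)
    (hint : Integrable (fun y => |h y| ^ (5 / 3 : ℝ)) (Measure.pi fun _ : Fin m => F))
    {A l : ℕ → ℝ} (hnorm : IsNormalNorming P (fun i ω => hTilde F h (X i ω)) A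
      (fun n => Real.sqrt n * l n)) :
    TendstoInMeasure P (fun (n : ℕ) ω => jackVar h n (fun i => X i ω) / ((m : ℝ) ^ 2 * l n ^ 2))
      atTop (fun _ => 1) := by
  have hm : 1 ≤ m := Nat.one_le_iff_ne_zero.2 (NeZero.ne m)
  have hint1 : Integrable h (Measure.pi fun _ : Fin m => F) :=
    integrable_of_integrable_rpow_abs (by norm_num) hmeas.aestronglyMeasurable hint
  have hTm : Measurable (hTilde F h) := measurable_hTilde hmeas
  set Y : ℕ → Ω → ℝ := fun i ω => hTilde F h (X i ω) with hYdef
  have hYm : ∀ i, Measurable (Y i) := fun i => hTm.comp (hX i)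
  have hYind : iIndepFun Y P := hindep.comp (fun _ => hTilde F h) fun _ => hTm
  have hYlaw : ∀ i, P.map (Y i) = F.map (hTilde F h) := fun i => by
    have := Measure.map_map (μ := P) hTm (hX i)
    rw [hlaw i] at this
    exact this.symm
  have := Measure.isProbabilityMeasure_map (μ := F) hTm.aemeasurable
  have hmean : ∫ y, y ∂(F.map (hTilde F h)) = 0 := by
    rw [integral_map hTm.aemeasurable (by fun_prop)]
    exact integral_hTilde hmeas hint1
  obtain ⟨⟨c, hc, hcB⟩, hraikov⟩ := tendstoInMeasure_sum_sq_div_sq_norming hYm hYind hYlaw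
    ((integrable_map_measure (by fun_prop) hTm.aemeasurable).2 (integrable_hTilde hmeas hint1))
    ((integrable_map_measure (Measurable.aestronglyMeasurable (by fun_prop)) hTm.aemeasurable).2
      (integrable_abs_hTilde_rpow hmeas hint)) hmean hnorm
  set R : ℕ → ℕ → Ω → ℝ := fun n i ω =>
    throughAvg h n i (fun k => X k ω) - theta F h - Y i ω with hRdef
  have hrem : TendstoInMeasure P (fun (n : ℕ) ω => (∑ i ∈ Finset.range n, R n i ω ^ 2) / n) atTop
      (fun _ => 0) := by
    have h1 := tendstoInMeasure_sum_throughAvg_sub_proj_sq hX hindep hlaw hmeas hsymm hint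
    refine h1.congr_left fun n => ae_of_all _ fun ω => ?_
    simp only [hRdef, hYdef, hTilde_eq_proj_sub]
    congr 1
    refine Finset.sum_congr rfl fun i _ => ?_
    ring
  have hslln : TendstoInMeasure P (fun (n : ℕ) ω => (∑ i ∈ Finset.range n, Y i ω) / n) atTop
      (fun _ => 0) := by
    refine tendstoInMeasure_of_tendsto_ae (fun n => Measurable.aestronglyMeasurable (by fun_prop)) ?_
    have hXi : MeasurePreserving (X 0) P F := ⟨hX 0, hlaw 0⟩
    have hY0 : ∫ ω, Y 0 ω ∂P = 0 := by
      rw [← hmean, ← hYlaw 0, integral_map (hYm 0).aemeasurable (by fun_prop)]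
    have h1 := strong_law_ae_real Y
      (hXi.integrable_comp_of_integrable (integrable_hTilde hmeas hint1))
      (fun i j hij => hYind.indepFun hij)
      (fun i => ⟨(hYm i).aemeasurable, (hYm 0).aemeasurable, by rw [hYlaw, hYlaw]⟩)
    rwa [hY0] at h1
  have hB : ∀ n : ℕ, (Real.sqrt n * l n) ^ 2 = n * l n ^ 2 := fun n => by
    rw [mul_pow, Real.sq_sqrt (Nat.cast_nonneg n)]
  simp only [hB] at hcB hraikov
  -- Since Bₙ² = n ℓ², the bound c n ≤ Bₙ² says that ℓ² stays away from zero; remainders that vanish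
  -- without ℓ² therefore still vanish after division by it.
  have hcl : ∀ᶠ n in atTop, c ≤ l n ^ 2 := by
    filter_upwards [hcB, eventually_ge_atTop 1] with n hn h1
    have hn0 : (0 : ℝ) < n := by exact_mod_cast h1
    rw [mul_comm] at hn
    exact le_of_mul_le_mul_left hn hn0
  have hrdiv : TendstoInMeasure P
      (fun (n : ℕ) ω => (∑ i ∈ Finset.range n, R n i ω ^ 2) / n / c) atTop (fun _ => 0) := by
    have := tendstoInMeasure_comp_continuousAt hrem (g := fun u : ℝ => u / c)
      (by fun_prop)
    simpa using this
  have hrle : ∀ᶠ n : ℕ in atTop, ∀ ω, (∑ i ∈ Finset.range n, R n i ω ^ 2) / (n * l n ^ 2)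
      ≤ (∑ i ∈ Finset.range n, R n i ω ^ 2) / n / c := by
    filter_upwards [hcl] with n hn ω
    rw [← div_div]
    gcongr
  have hT3 : TendstoInMeasure P
      (fun (n : ℕ) ω => (∑ i ∈ Finset.range n, R n i ω ^ 2) / (n * l n ^ 2)) atTop
      (fun _ => 0) := by
    refine tendstoInMeasure_zero_of_abs_le hrdiv ?_
    filter_upwards [hrle] with n hn
    refine ae_of_all _ fun ω => ?_
    rw [abs_of_nonneg (by positivity)]
    exact hn ω
  have hT2 : TendstoInMeasure P
      (fun (n : ℕ) ω => (∑ i ∈ Finset.range n, Y i ω * R n i ω) / (n * l n ^ 2)) atTop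
      (fun _ => 0) := by
    have h1 := tendstoInMeasure_comp₂ hraikov hT3
      (fun u v => Real.sqrt u * Real.sqrt v) (by fun_prop)
    simp only [Real.sqrt_zero, mul_zero] at h1
    exact tendstoInMeasure_zero_of_abs_le h1 (Eventually.of_forall fun n => ae_of_all _ fun ω =>
      abs_sum_mul_div_le _ _ _ (by positivity))
  have hT4 : TendstoInMeasure P
      (fun (n : ℕ) ω => ((∑ i ∈ Finset.range n, Y i ω + ∑ i ∈ Finset.range n, R n i ω) / n) ^ 2
        / l n ^ 2) atTop (fun _ => 0) := by
    have h1 := tendstoInMeasure_comp₂ hslln hrem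
      (fun u v => (2 * u ^ 2 + 2 * v) / c) (by fun_prop)
    simp only [ne_eq, OfNat.ofNat_ne_zero, not_false_eq_true, zero_pow, mul_zero, add_zero,
      zero_div] at h1
    refine tendstoInMeasure_zero_of_abs_le h1 ?_
    filter_upwards [hcl] with n hn
    refine ae_of_all _ fun ω => ?_
    rw [abs_of_nonneg (by positivity)]
    gcongr
    exact sq_add_div_le n _ _
  -- The four terms of `sum_throughAvg_sub_sq` divided by n ℓ²: the squares of Y tend to 1, the
  -- other three to 0.
  have h23 := tendstoInMeasure_comp₂ hT2 hT3 (fun u v => 2 * u + v) (by fun_prop)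
  have h234 := tendstoInMeasure_comp₂ h23 hT4 (fun u v => u - v) (by fun_prop)
  have hsum := tendstoInMeasure_comp₂ hraikov h234 (fun u v => u + v) (by fun_prop)
  have hfin := tendstoInMeasure_comp₂
    (tendstoInMeasure_const_of_tendsto (P := P) (tendsto_jackknife_factor m)) hsum
    (fun u v => u * v) (by fun_prop)
  simp only [mul_zero, add_zero, sub_zero, mul_one] at hfin
  refine hfin.congr' ?_ (ae_eq_refl _)
  filter_upwards [eventually_gt_atTop m, hcl] with n hn hl
  refine ae_of_all _ fun ω => ?_
  have hn0 : (0 : ℝ) < n := by exact_mod_cast (by omega : 0 < n)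
  have hm0 : (0 : ℝ) < m := by exact_mod_cast hm
  have hnm : (0 : ℝ) < (n : ℝ) - m := by
    have : (m : ℝ) < n := by exact_mod_cast hn
    linarith
  have hl0 : l n ≠ 0 := fun h0 => by
    rw [h0] at hl; norm_num at hl; linarith
  simp only
  rw [jackVar_eq hm h hn, sum_throughAvg_sub_sq hm h hn _ (fun i => Y i ω) (theta F h)]
  simp only [hRdef]
  field_simp
  ring

/-- The classical central limit theorem for the first projection. -/
lemma isNormalNorming_of_sq_integrable (hint : Integrable h (Measure.pi fun _ : Fin m => F))
    (hv : 0 < ∫ x, hTilde F h x ^ 2 ∂F) :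
    IsNormalNorming P (fun i ω => hTilde F h (X i ω)) (fun _ => 0)
      (fun n => Real.sqrt n * Real.sqrt (∫ x, hTilde F h x ^ 2 ∂F)) := by
  set v := ∫ x, hTilde F h x ^ 2 ∂F with hvdef
  have hTm : Measurable (hTilde F h) := measurable_hTilde hmeas
  refine ⟨fun n hn => mul_pos (Real.sqrt_pos.2 (by exact_mod_cast hn)) (Real.sqrt_pos.2 hv), ?_⟩
  have hZm : Measurable fun x => hTilde F h x / Real.sqrt v := hTm.div_const _
  have h0 : ∫ ω, hTilde F h (X 0 ω) / Real.sqrt v ∂P = 0 := by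
    have h1 := integral_map (μ := P) (hX 0).aemeasurable
      (f := fun x => hTilde F h x / Real.sqrt v) hZm.aestronglyMeasurable
    rw [hlaw 0] at h1
    rw [← h1, integral_div, integral_hTilde hmeas hint, zero_div]
  have h1 : ∫ ω, (hTilde F h (X 0 ω) / Real.sqrt v) ^ 2 ∂P = 1 := by
    have h2 := integral_map (μ := P) (hX 0).aemeasurable
      (f := fun x => (hTilde F h x / Real.sqrt v) ^ 2) (hZm.pow_const 2).aestronglyMeasurable
    rw [hlaw 0] at h2
    rw [← h2]
    simp only [div_pow, Real.sq_sqrt hv.le]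
    rw [integral_div, div_self hv.ne']
  have hclt := tendstoInDistribution_inv_sqrt_mul_sum (P := P)
    (X := fun i ω => hTilde F h (X i ω) / Real.sqrt v) (Y := (id : ℝ → ℝ))
    (P' := gaussianReal 0 1) HasLaw.id h0 h1
    (hindep.comp (fun _ x => hTilde F h x / Real.sqrt v) fun _ => hZm)
    (fun i => ⟨(hZm.comp (hX i)).aemeasurable, (hZm.comp (hX 0)).aemeasurable, by
      change P.map ((fun x => hTilde F h x / Real.sqrt v) ∘ X i)
        = P.map ((fun x => hTilde F h x / Real.sqrt v) ∘ X 0)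
      rw [← Measure.map_map hZm (hX i), ← Measure.map_map hZm (hX 0), hlaw, hlaw]⟩)
  refine hclt.congr (fun n => ae_of_all _ fun ω => ?_) (ae_eq_refl _)
  simp only [sub_zero]
  rw [← Finset.sum_div]
  field_simp

/-- A vanishing second moment would make h̃₁(X₁) almost surely zero, which is incompatible with
attraction to the normal law. -/
lemma integral_hTilde_sq_pos (hdan : InDAN P (fun i ω => hTilde F h (X i ω)))
    (hint : Integrable (fun x => hTilde F h x ^ 2) F) : 0 < ∫ x, hTilde F h x ^ 2 ∂F := by
  obtain ⟨A, B, hnorm⟩ := hdan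
  have hTm : Measurable (hTilde F h) := measurable_hTilde hmeas
  have hne : ¬ ∀ᵐ y ∂(F.map (hTilde F h)), y = 0 :=
    have := Measure.isProbabilityMeasure_map (μ := F) hTm.aemeasurable
    not_ae_eq_zero_of_tendsto_charFun (tendsto_norm_charFun_pow (fun i => hTm.comp (hX i))
      (hindep.comp (fun _ => hTilde F h) fun _ => hTm)
      (fun i => by
        have := Measure.map_map (μ := P) hTm (hX i)
        rw [hlaw i] at this
        exact this.symm) hnorm)
  refine (integral_nonneg fun x => sq_nonneg _).lt_of_ne fun h0 => hne ?_
  refine (ae_map_iff hTm.aemeasurable (measurableSet_singleton (0 : ℝ))).2 ?_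
  have := (integral_eq_zero_iff_of_nonneg (fun x => sq_nonneg _) hint).1 h0.symm
  filter_upwards [this] with x hx
  exact pow_eq_zero_iff two_ne_zero |>.1 hx

end Main

end JackknifeU

/-! ### The main theorem. -/

theorem corollary1 {Ω : Type*} [MeasurableSpace Ω] (P : Measure Ω) [IsProbabilityMeasure P]
    (F : Measure ℝ) [IsProbabilityMeasure F]
    (X : ℕ → Ω → ℝ) (hX : ∀ i, Measurable (X i)) (hindep : iIndepFun X P)
    (hlaw : ∀ i, P.map (X i) = F)
    (m : ℕ) [NeZero m] (h : (Fin m → ℝ) → ℝ) (hmeas : Measurable h)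
    (hsymm : ∀ (σ : Equiv.Perm (Fin m)) (y : Fin m → ℝ), h (fun k => y (σ k)) = h y)
    (hmoment : Integrable (fun ω => |h (fun k => X k ω)| ^ (5 / 3 : ℝ)) P)
    (hDAN : JackknifeU.InDAN P (fun i ω => JackknifeU.hTilde F h (X i ω))) :
    (∀ A ℓ : ℕ → ℝ,
      JackknifeU.IsNormalNorming P (fun i ω => JackknifeU.hTilde F h (X i ω)) A
        (fun n => Real.sqrt n * ℓ n) →
      TendstoInMeasure P
        (fun (n : ℕ) ω =>
          JackknifeU.jackVar h n (fun i => X i ω) / ((m : ℝ) ^ 2 * ℓ n ^ 2))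
        atTop (fun _ => 1)) ∧
    (Integrable (fun ω => h (fun k => X k ω) ^ 2) P →
      0 < ∫ x, JackknifeU.hTilde F h x ^ 2 ∂F ∧
      JackknifeU.IsNormalNorming P (fun i ω => JackknifeU.hTilde F h (X i ω)) (fun _ => 0)
        (fun n => Real.sqrt n * Real.sqrt (∫ x, JackknifeU.hTilde F h x ^ 2 ∂F)) ∧
      TendstoInMeasure P
        (fun (n : ℕ) ω => JackknifeU.jackVar h n (fun i => X i ω) / (m : ℝ) ^ 2)
        atTop (fun _ => ∫ x, JackknifeU.hTilde F h x ^ 2 ∂F)) := by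
  have hmp := JackknifeU.measurePreserving_tuple hX hindep hlaw (j := fun k : Fin m => (k : ℕ))
    Fin.val_injective
  have hint : Integrable (fun y => |h y| ^ (5 / 3 : ℝ)) (Measure.pi fun _ : Fin m => F) := by
    rw [← hmp.map_eq]
    exact (integrable_map_measure (hmeas.abs.pow_const _).aestronglyMeasurable
      hmp.measurable.aemeasurable).2 hmoment
  have hint1 : Integrable h (Measure.pi fun _ : Fin m => F) :=
    JackknifeU.integrable_of_integrable_rpow_abs (by norm_num) hmeas.aestronglyMeasurable hint
  have hfirst := fun A ℓ => JackknifeU.tendstoInMeasure_jackVar_div hX hindep hlaw hmeas hsymm hint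
    (A := A) (l := ℓ)
  refine ⟨hfirst, fun hsq => ?_⟩
  have hint2 : Integrable (fun y => h y ^ 2) (Measure.pi fun _ : Fin m => F) := by
    rw [← hmp.map_eq]
    exact (integrable_map_measure (hmeas.pow_const _).aestronglyMeasurable
      hmp.measurable.aemeasurable).2 hsq
  have hT2 : Integrable (fun x => JackknifeU.hTilde F h x ^ 2) F := by
    have h1 := (memLp_two_iff_integrable_sq
      (JackknifeU.measurable_proj F hmeas).aestronglyMeasurable).2
      (JackknifeU.integrable_proj_sq_and_integral_le F hmeas hint2).1
    exact (h1.sub (memLp_const (JackknifeU.theta F h))).integrable_sq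
  have hv := JackknifeU.integral_hTilde_sq_pos hX hindep hlaw hmeas hDAN hT2
  have hnorm := JackknifeU.isNormalNorming_of_sq_integrable hX hindep hlaw hmeas hint1 hv
  refine ⟨hv, hnorm, ?_⟩
  -- The general law with constant ℓ = (E h̃₁²)^(1/2), multiplied through by E h̃₁².
  have h1 := JackknifeU.tendstoInMeasure_comp_continuousAt (hfirst _ _ hnorm)
    (g := fun u : ℝ => u * ∫ x, JackknifeU.hTilde F h x ^ 2 ∂F) (by fun_prop)
  simp only [one_mul] at h1
  refine h1.congr_left fun n => ae_of_all _ fun ω => ?_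
  have hm0 : (m : ℝ) ≠ 0 := Nat.cast_ne_zero.2 (NeZero.ne m)
  simp only
  rw [Real.sq_sqrt hv.le]
  field_simp
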